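/- Let $k$ be a commutative ring, $A$ and $L$ associative unital $k$-algebras, $\mathcal C$ an $A$-coring (an $A$-$A$ bimodule with coassociative counital $A$-bilinear coproduct $\Delta$ and counit $\epsilon$) and $\mathcal D$ an $L$-coring. Write $\mathcal M^{\mathcal C}$ for the category of right $\mathcal C$-comodules and $m\mapsto m^{[0]}\otimes_A m^{[1]}$ for their coactions $\varrho$. Assume that $\mathcal D$ is a *right extension* of $\mathcal C$: $\mathcal C$ also carries a right $L$-action commuting with the left $A$-action, for which $\Delta$ is right $L$-linear, and a left $A$-linear right $\mathcal D$-coaction $\tau:c\mapsto c_{[0]}\otimes_L c_{[1]}$ for which $\Delta$ is right $\mathcal D$-colinear. Every $M\in\mathcal M^{\mathcal C}$ is then a right $L$-module by $ml=m^{[0]}\epsilon(m^{[1]}l)$. Assume that the extension is *pure*: for every right $\mathcal C$-comodule $M$ the equaliser $$M\xrightarrow{\ \varrho\ }M\otimes_A\mathcal C\rightrightarrows M\otimes_A\mathcal C\otimes_A\mathcal C$$ of $\varrho\otimes_A\mathcal C$ and $M\otimes_A\Delta$ in the category of right $L$-modules is preserved by $-\otimes_L\mathcal D\otimes_L\mathcal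 D$. Then $M$ has a right $\mathcal D$-coaction $\tau_M:M\to M\otimes_L\mathcal D$, the unique map with $(\varrho\otimes_L\mathcal D)\tau_M=(M\otimes_A\tau)\varrho$. Let $\Sigma$ be an $L$-$\mathcal C$ bicomodule (a left $L$-module and right $\mathcal C$-comodule with left $L$-linear coaction), and let $T=\mathrm{End}^{\mathcal C}(\Sigma)$, an $L$-ring via $l\mapsto(x\mapsto lx)$. Let $\Sigma^*=\mathrm{Hom}_A(\Sigma,A)$ with $(a\xi l)(x)=a\,\xi(lx)$, and let $$\widetilde Q=\{q\in{}_A\mathrm{Hom}_L(\mathcal C,\Sigma^*)\mid c^{(1)}q(c^{(2)})(x)=q(c)(x^{[0]})x^{[1]}\ \text{for all } x\in\Sigma,\ c\in\mathcal C\}.$$ The Morita context $\widetilde{\mathbb M}(\Sigma)$ connects the algebras ${}_L\mathrm{Hom}_L(\mathcal D,T)$ and ${}^{\mathcal C}\mathrm{End}^{\mathcal D}(\mathcal C)^{op}$ by the bimodules ${}_L\mathrm{Hom}^{\mathcal D}(\mathcal D,\Sigma)$ and $\widetilde Q$; its connecting maps $\widetilde Q\otimes{}_L\mathrm{Hom}^{\mathcal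 D}(\mathcal D,\Sigma)\to{}^{\mathcal C}\mathrm{End}^{\mathcal D}(\mathcal C)^{op}$ and ${}_L\mathrm{Hom}^{\mathcal D}(\mathcal D,\Sigma)\otimes\widetilde Q\to{}_L\mathrm{Hom}_L(\mathcal D,T)$ (tensor products over the respective algebras) are $$q\otimes p\mapsto\big(c\mapsto q(c_{[0]})(p(c_{[1]})^{[0]})\,p(c_{[1]})^{[1]}\big),\qquad p\otimes q\mapsto\big(d\mapsto p(d)^{[0]}\,q(p(d)^{[1]})(-)\big).$$ **Strong Structure Theorem.** Suppose that $\widetilde{\mathbb M}(\Sigma)$ is strict, i.e. both connecting maps are surjective, and that there are finitely many elements $v_j\in{}_L\mathrm{Hom}_L(\mathcal D,T)$ and $d_j\in\mathcal D$ with $\sum_j v_j(d_j)=1_T$. Then the functors $-\otimes_T\Sigma:\mathcal M_T\to\mathcal M^{\mathcal C}$ and $\mathrm{Hom}^{\mathcal C}(\Sigma,-):\mathcal M^{\mathcal C}\to\mathcal M_T$ are inverse equivalences. -/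

import Mathlib

set_option linter.unusedVariables false
set_option linter.unusedSectionVars false

open CategoryTheory MulOpposite

universe u

noncomputable section

namespace CoringExt

/-! ## Balanced tensor products over a possibly noncommutative ring

A right `R`-module is a `Module Rᵐᵒᵖ M`, with `op r • m` for `m r`; an `R`-`S` bimodule carries
commuting actions of `R` and of `Sᵐᵒᵖ`. -/

section BTensor

open TensorProduct in
/-- The subgroup of `M ⊗ N` generated by the elements `m r ⊗ n - m ⊗ r n`. -/
def balancing (R : Type*) [Ring R] (M : Type*) [AddCommGroup M] [Module Rᵐᵒᵖ M]
    (N : Type*) [AddCommGroup N] [Module R N] : AddSubgroup (M ⊗[ℤ] N) :=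
  AddSubgroup.closure {z | ∃ (m : M) (r : R) (n : N),
    z = (op r • m) ⊗ₜ[ℤ] n - m ⊗ₜ[ℤ] (r • n)}

open TensorProduct in
/-- The tensor product over `R` of a right `R`-module `M` and a left `R`-module `N`. -/
def BTensor (R : Type*) [Ring R] (M : Type*) [AddCommGroup M] [Module Rᵐᵒᵖ M]
    (N : Type*) [AddCommGroup N] [Module R N] : Type _ :=
  (M ⊗[ℤ] N) ⧸ balancing R M N

notation:100 M:100 " ⊗ᴮ[" R "] " N:101 => BTensor R M N

variable {R S : Type*} [Ring R] [Ring S]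
variable {M M' M'' N N' N'' P : Type*}
  [AddCommGroup M] [Module Rᵐᵒᵖ M] [AddCommGroup M'] [Module Rᵐᵒᵖ M']
  [AddCommGroup M''] [Module Rᵐᵒᵖ M'']
  [AddCommGroup N] [Module R N] [AddCommGroup N'] [Module R N']
  [AddCommGroup N''] [Module R N''] [AddCommGroup P]

instance : AddCommGroup (M ⊗ᴮ[R] N) :=
  inferInstanceAs (AddCommGroup ((TensorProduct ℤ M N) ⧸ balancing R M N))

namespace BTensor

variable (R) in
/-- The pure tensor `m ⊗ n`. -/
def tmul (m : M) (n : N) : M ⊗ᴮ[R] N :=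
  QuotientAddGroup.mk (TensorProduct.tmul ℤ m n)

theorem add_tmul (m m' : M) (n : N) : tmul R (m + m') n = tmul R m n + tmul R m' n :=
  congrArg QuotientAddGroup.mk (TensorProduct.add_tmul m m' n)

theorem tmul_add (m : M) (n n' : N) : tmul R m (n + n') = tmul R m n + tmul R m n' :=
  congrArg QuotientAddGroup.mk (TensorProduct.tmul_add m n n')

theorem smul_tmul (r : R) (m : M) (n : N) : tmul R (op r • m) n = tmul R m (r • n) :=
  (QuotientAddGroup.eq_iff_sub_mem (N := balancing R M N)).2
    (AddSubgroup.subset_closure ⟨m, r, n, rfl⟩)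

/-- The map out of the tensor product induced by a balanced biadditive map. -/
def lift (f : M → N → P) (h₁ : ∀ m m' n, f (m + m') n = f m n + f m' n)
    (h₂ : ∀ m n n', f m (n + n') = f m n + f m n')
    (h₃ : ∀ (r : R) m n, f (op r • m) n = f m (r • n)) : M ⊗ᴮ[R] N →+ P :=
  QuotientAddGroup.lift (balancing R M N)
    (TensorProduct.liftAddHom (R := ℤ)
      (AddMonoidHom.mk' (fun m => AddMonoidHom.mk' (f m) (h₂ m))
        (fun a b => AddMonoidHom.ext (h₁ a b)))
      (fun r m n => by rw [map_zsmul, map_zsmul]; rfl)) (by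
      refine (AddSubgroup.closure_le _).2 ?_
      rintro _ ⟨m, r, n, rfl⟩
      refine (AddMonoidHom.mem_ker).2 ?_
      rw [map_sub]
      exact sub_eq_zero.2 (h₃ r m n))

@[simp] theorem lift_tmul (f : M → N → P) (h₁ h₂ h₃) (m : M) (n : N) :
    lift (R := R) f h₁ h₂ h₃ (tmul R m n) = f m n := rfl

theorem zero_tmul (n : N) : tmul R (0 : M) n = 0 := by
  have : tmul R (0 : M) n + tmul R (0 : M) n = tmul R (0 : M) n := by
    rw [← add_tmul, add_zero]
  simpa using this

theorem tmul_zero (m : M) : tmul R m (0 : N) = 0 := by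
  have : tmul R m (0 : N) + tmul R m (0 : N) = tmul R m (0 : N) := by
    rw [← tmul_add, add_zero]
  simpa using this

@[elab_as_elim]
theorem induction_on {motive : M ⊗ᴮ[R] N → Prop} (z : M ⊗ᴮ[R] N)
    (tm : ∀ m n, motive (tmul R m n))
    (plus : ∀ x y, motive x → motive y → motive (x + y)) : motive z := by
  obtain ⟨t, rfl⟩ := QuotientAddGroup.mk_surjective z
  induction t with
  | zero =>
    have h := tm 0 0
    rw [zero_tmul] at h
    exact h
  | tmul x y => exact tm x y
  | add x y hx hy => exact plus _ _ hx hy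

theorem hom_ext {f g : M ⊗ᴮ[R] N →+ P} (h : ∀ m n, f (tmul R m n) = g (tmul R m n)) : f = g := by
  ext z
  induction z using induction_on with
  | tm m n => exact h m n
  | plus x y hx hy => rw [map_add, map_add, hx, hy]

/-- The tensor product `f ⊗ g` of a right linear and a left linear map. -/
def map (f : M →ₗ[Rᵐᵒᵖ] M') (g : N →ₗ[R] N') : M ⊗ᴮ[R] N →+ M' ⊗ᴮ[R] N' :=
  lift (fun m n => tmul R (f m) (g n)) (fun a b n => by rw [map_add, add_tmul])
    (fun m a b => by rw [map_add, tmul_add])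
    (fun r m n => by rw [map_smul, map_smul, smul_tmul])

@[simp] theorem map_tmul (f : M →ₗ[Rᵐᵒᵖ] M') (g : N →ₗ[R] N') (m : M) (n : N) :
    map f g (tmul R m n) = tmul R (f m) (g n) := rfl

theorem map_map (f' : M' →ₗ[Rᵐᵒᵖ] M'') (g' : N' →ₗ[R] N'') (f : M →ₗ[Rᵐᵒᵖ] M')
    (g : N →ₗ[R] N') (z : M ⊗ᴮ[R] N) :
    map f' g' (map f g z) = map (f' ∘ₗ f) (g' ∘ₗ g) z := by
  induction z using induction_on with
  | tm m n => rfl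
  | plus x y hx hy => simp only [map_add, hx, hy]

@[simp] theorem map_id (z : M ⊗ᴮ[R] N) :
    map (LinearMap.id : M →ₗ[Rᵐᵒᵖ] M) (LinearMap.id : N →ₗ[R] N) z = z := by
  induction z using induction_on with
  | tm m n => rfl
  | plus x y hx hy => simp only [map_add, hx, hy]

theorem map_add_left (f f' : M →ₗ[Rᵐᵒᵖ] M') (g : N →ₗ[R] N') (z : M ⊗ᴮ[R] N) :
    map (f + f') g z = map f g z + map f' g z := by
  induction z using induction_on with
  | tm m n => rw [map_tmul, LinearMap.add_apply, add_tmul]; rfl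
  | plus x y hx hy => simp only [map_add, hx, hy]; abel

theorem map_add_right (f : M →ₗ[Rᵐᵒᵖ] M') (g g' : N →ₗ[R] N') (z : M ⊗ᴮ[R] N) :
    map f (g + g') z = map f g z + map f g' z := by
  induction z using induction_on with
  | tm m n => rw [map_tmul, LinearMap.add_apply, tmul_add]; rfl
  | plus x y hx hy => simp only [map_add, hx, hy]; abel

/-- `f ⊗ g`, as an additive function of `f`. -/
def mapLeftHom (g : N →ₗ[R] N') (z : M ⊗ᴮ[R] N) : (M →ₗ[Rᵐᵒᵖ] M') →+ M' ⊗ᴮ[R] N' :=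
  AddMonoidHom.mk' (fun f => map f g z) (fun f f' => map_add_left f f' g z)

/-- `f ⊗ g`, as an additive function of `g`. -/
def mapRightHom (f : M →ₗ[Rᵐᵒᵖ] M') (z : M ⊗ᴮ[R] N) : (N →ₗ[R] N') →+ M' ⊗ᴮ[R] N' :=
  AddMonoidHom.mk' (fun g => map f g z) (fun g g' => map_add_right f g g' z)

@[simp] theorem mapLeftHom_apply (f : M →ₗ[Rᵐᵒᵖ] M') (g : N →ₗ[R] N') (z : M ⊗ᴮ[R] N) :
    mapLeftHom g z f = map f g z := rfl

@[simp] theorem mapRightHom_apply (f : M →ₗ[Rᵐᵒᵖ] M') (g : N →ₗ[R] N') (z : M ⊗ᴮ[R] N) :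
    mapRightHom f z g = map f g z := rfl

/-- Left multiplication by `s`, on a module where it commutes with the right action of `R`. -/
def smulHom (R : Type*) [Ring R] {M : Type*} [AddCommGroup M] [Module R M]
    {S : Type*} [Ring S] [Module S M] [SMulCommClass S R M] (s : S) : M →ₗ[R] M where
  toFun m := s • m
  map_add' := smul_add s
  map_smul' r m := smul_comm s r m

@[simp] theorem smulHom_apply {M : Type*} [AddCommGroup M] [Module R M]
    [Module S M] [SMulCommClass S R M] (s : S) (m : M) : smulHom R s m = s • m := rfl

/-- A left action on the first factor acts on the tensor product. -/
instance leftModule [Module S M] [SMulCommClass S Rᵐᵒᵖ M] : Module S (M ⊗ᴮ[R] N) where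
  smul s z := map (smulHom Rᵐᵒᵖ s) LinearMap.id z
  one_smul z := by
    change map (smulHom Rᵐᵒᵖ (1 : S)) LinearMap.id z = z
    induction z using induction_on with
    | tm m n => simp
    | plus x y hx hy => simp only [map_add, hx, hy]
  mul_smul s t z := by
    change map (smulHom Rᵐᵒᵖ (s * t)) LinearMap.id z =
      map (smulHom Rᵐᵒᵖ s) LinearMap.id (map (smulHom Rᵐᵒᵖ t) LinearMap.id z)
    induction z using induction_on with
    | tm m n => simp [mul_smul]
    | plus x y hx hy => simp only [map_add, hx, hy]
  smul_zero s := map_zero _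
  smul_add s := map_add _
  add_smul s t z := by
    change map (smulHom Rᵐᵒᵖ (s + t)) LinearMap.id z =
      map (smulHom Rᵐᵒᵖ s) LinearMap.id z + map (smulHom Rᵐᵒᵖ t) LinearMap.id z
    induction z using induction_on with
    | tm m n => simp [add_smul, add_tmul]
    | plus x y hx hy => simp only [map_add, hx, hy]; abel
  zero_smul z := by
    change map (smulHom Rᵐᵒᵖ (0 : S)) LinearMap.id z = 0
    induction z using induction_on with
    | tm m n => simp [zero_tmul]
    | plus x y hx hy => simp only [map_add, hx, hy, add_zero]

/-- A right action on the second factor acts on the tensor product. -/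
instance rightModule [Module Sᵐᵒᵖ N] [SMulCommClass R Sᵐᵒᵖ N] : Module Sᵐᵒᵖ (M ⊗ᴮ[R] N) :=
  letI (s : Sᵐᵒᵖ) : N →ₗ[R] N :=
    haveI : SMulCommClass Sᵐᵒᵖ R N := SMulCommClass.symm _ _ _
    smulHom R s
  { smul := fun s z => map LinearMap.id (this s) z
    one_smul := fun z => by
      change map LinearMap.id (this 1) z = z
      induction z using induction_on with
      | tm m n => simp [this]
      | plus x y hx hy => simp only [map_add, hx, hy]
    mul_smul := fun s t z => by
      change map LinearMap.id (this (s * t)) z =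
        map LinearMap.id (this s) (map LinearMap.id (this t) z)
      induction z using induction_on with
      | tm m n => simp [this, mul_smul]
      | plus x y hx hy => simp only [map_add, hx, hy]
    smul_zero := fun s => map_zero _
    smul_add := fun s => map_add _
    add_smul := fun s t z => by
      change map LinearMap.id (this (s + t)) z =
        map LinearMap.id (this s) z + map LinearMap.id (this t) z
      induction z using induction_on with
      | tm m n => simp [this, add_smul, tmul_add]
      | plus x y hx hy => simp only [map_add, hx, hy]; abel
    zero_smul := fun z => by
      change map LinearMap.id (this 0) z = 0
      induction z using induction_on with
      | tm m n => simp [this, tmul_zero]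
      | plus x y hx hy => simp only [map_add, hx, hy, add_zero] }

theorem left_smul_tmul [Module S M] [SMulCommClass S Rᵐᵒᵖ M] (s : S) (m : M) (n : N) :
    s • tmul R m n = tmul R (s • m) n := rfl

theorem right_smul_tmul [Module Sᵐᵒᵖ N] [SMulCommClass R Sᵐᵒᵖ N] (s : Sᵐᵒᵖ) (m : M) (n : N) :
    s • tmul R m n = tmul R m (s • n) := rfl

instance bimodule {S' : Type*} [Ring S'] [Module S M] [SMulCommClass S Rᵐᵒᵖ M]
    [Module S'ᵐᵒᵖ N] [SMulCommClass R S'ᵐᵒᵖ N] : SMulCommClass S S'ᵐᵒᵖ (M ⊗ᴮ[R] N) where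
  smul_comm s t z := by
    induction z using induction_on with
    | tm m n => rfl
    | plus x y hx hy => simp only [smul_add, hx, hy]

/-- `f ⊗ g` as a left `S`-linear map. -/
def mapL [Module S M] [SMulCommClass S Rᵐᵒᵖ M] [Module S M'] [SMulCommClass S Rᵐᵒᵖ M']
    (f : M →ₗ[Rᵐᵒᵖ] M') (g : N →ₗ[R] N') (hf : ∀ (s : S) m, f (s • m) = s • f m) :
    M ⊗ᴮ[R] N →ₗ[S] M' ⊗ᴮ[R] N' where
  toFun := map f g
  map_add' := map_add _
  map_smul' s z := by
    induction z using induction_on with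
    | tm m n => simp [left_smul_tmul, hf]
    | plus x y hx hy => simp only [map_add, smul_add, hx, hy]

/-- `f ⊗ g` as a right `S`-linear map. -/
def mapR [Module Sᵐᵒᵖ N] [SMulCommClass R Sᵐᵒᵖ N] [Module Sᵐᵒᵖ N'] [SMulCommClass R Sᵐᵒᵖ N']
    (f : M →ₗ[Rᵐᵒᵖ] M') (g : N →ₗ[R] N') (hg : ∀ (s : Sᵐᵒᵖ) n, g (s • n) = s • g n) :
    M ⊗ᴮ[R] N →ₗ[Sᵐᵒᵖ] M' ⊗ᴮ[R] N' where
  toFun := map f g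
  map_add' := map_add _
  map_smul' s z := by
    induction z using induction_on with
    | tm m n => simp [right_smul_tmul, hg]
    | plus x y hx hy => simp only [map_add, smul_add, hx, hy]

@[simp] theorem mapL_apply [Module S M] [SMulCommClass S Rᵐᵒᵖ M] [Module S M']
    [SMulCommClass S Rᵐᵒᵖ M'] (f : M →ₗ[Rᵐᵒᵖ] M') (g : N →ₗ[R] N')
    (hf : ∀ (s : S) m, f (s • m) = s • f m) (z) : mapL f g hf z = map f g z := rfl

@[simp] theorem mapR_apply [Module Sᵐᵒᵖ N] [SMulCommClass R Sᵐᵒᵖ N] [Module Sᵐᵒᵖ N']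
    [SMulCommClass R Sᵐᵒᵖ N'] (f : M →ₗ[Rᵐᵒᵖ] M') (g : N →ₗ[R] N')
    (hg : ∀ (s : Sᵐᵒᵖ) n, g (s • n) = s • g n) (z) : mapR f g hg z = map f g z := rfl

section Assoc

variable {Q : Type*} [AddCommGroup Q] [Module S Q] [Module Sᵐᵒᵖ N] [SMulCommClass R Sᵐᵒᵖ N]

/-- For fixed `q`, the map `m ⊗ n ↦ m ⊗ (n ⊗ q)`. -/
def assocHomAux (q : Q) : M ⊗ᴮ[R] N →+ M ⊗ᴮ[R] (N ⊗ᴮ[S] Q) :=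
  lift (fun m n => tmul R m (tmul S n q)) (fun a b n => add_tmul _ _ _)
    (fun m a b => by rw [add_tmul, tmul_add])
    (fun r m n => by rw [smul_tmul, left_smul_tmul])

/-- `(m ⊗ n) ⊗ q ↦ m ⊗ (n ⊗ q)`. -/
def assocHom : (M ⊗ᴮ[R] N) ⊗ᴮ[S] Q →+ M ⊗ᴮ[R] (N ⊗ᴮ[S] Q) :=
  lift (fun z q => assocHomAux q z) (fun a b q => map_add _ _ _)
    (fun z a b => by
      induction z using induction_on with
      | tm m n => simp only [assocHomAux, lift_tmul, tmul_add]
      | plus x y hx hy => simp only [map_add, hx, hy]; abel)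
    (fun s z q => by
      induction z using induction_on with
      | tm m n => rw [right_smul_tmul]; simp only [assocHomAux, lift_tmul, smul_tmul]
      | plus x y hx hy => simp only [map_add, smul_add, hx, hy])

/-- For fixed `m`, the map `n ⊗ q ↦ (m ⊗ n) ⊗ q`. -/
def assocInvAux (m : M) : N ⊗ᴮ[S] Q →+ (M ⊗ᴮ[R] N) ⊗ᴮ[S] Q :=
  lift (fun n q => tmul S (tmul R m n) q) (fun a b q => by rw [tmul_add, add_tmul])
    (fun n a b => tmul_add _ _ _)
    (fun s n q => by rw [← smul_tmul, right_smul_tmul])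

/-- `m ⊗ (n ⊗ q) ↦ (m ⊗ n) ⊗ q`. -/
def assocInv : M ⊗ᴮ[R] (N ⊗ᴮ[S] Q) →+ (M ⊗ᴮ[R] N) ⊗ᴮ[S] Q :=
  lift (fun m z => assocInvAux m z)
    (fun a b z => by
      induction z using induction_on with
      | tm n q => simp only [assocInvAux, lift_tmul, add_tmul]
      | plus x y hx hy => simp only [map_add, hx, hy]; abel)
    (fun m a b => map_add _ _ _)
    (fun r m z => by
      induction z using induction_on with
      | tm n q => rw [left_smul_tmul]; simp only [assocInvAux, lift_tmul, smul_tmul]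
      | plus x y hx hy => simp only [map_add, smul_add, hx, hy])

/-- The associativity isomorphism `(M ⊗ N) ⊗ Q ≃ M ⊗ (N ⊗ Q)`. -/
def assoc : (M ⊗ᴮ[R] N) ⊗ᴮ[S] Q ≃+ M ⊗ᴮ[R] (N ⊗ᴮ[S] Q) where
  toFun := assocHom
  invFun := assocInv
  left_inv z := by
    suffices h : assocInv.comp assocHom = AddMonoidHom.id ((M ⊗ᴮ[R] N) ⊗ᴮ[S] Q) from
      DFunLike.congr_fun h z
    apply hom_ext
    intro t q
    induction t using induction_on with
    | tm m n => rfl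
    | plus x y hx hy => rw [add_tmul, map_add, map_add, hx, hy]
  right_inv z := by
    suffices h : assocHom.comp assocInv = AddMonoidHom.id (M ⊗ᴮ[R] (N ⊗ᴮ[S] Q)) from
      DFunLike.congr_fun h z
    apply hom_ext
    intro m t
    induction t using induction_on with
    | tm n q => rfl
    | plus x y hx hy => rw [tmul_add, map_add, map_add, hx, hy]
  map_add' := map_add _

@[simp] theorem assoc_tmul (m : M) (n : N) (q : Q) :
    assoc (tmul S (tmul R m n) q) = tmul R m (tmul S n q) := rfl

@[simp] theorem assoc_symm_tmul (m : M) (n : N) (q : Q) :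
    assoc.symm (tmul R m (tmul S n q)) = tmul S (tmul R m n) q := rfl

theorem assoc_map_left (f : M →ₗ[Rᵐᵒᵖ] M') (z : (M ⊗ᴮ[R] N) ⊗ᴮ[S] Q) :
    assoc (map (mapR f (LinearMap.id : N →ₗ[R] N) (S := S) (fun _ _ => rfl)) LinearMap.id z) =
      map f LinearMap.id (assoc z) := by
  induction z using induction_on with
  | tm t q =>
    induction t using induction_on with
    | tm m n => rfl
    | plus x y hx hy => simp only [add_tmul, map_add, hx, hy]
  | plus x y hx hy => simp only [map_add, hx, hy]

end Assoc

/-- The isomorphism `M ⊗ R → M`, `m ⊗ r ↦ m r`. -/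
def rid : M ⊗ᴮ[R] R →+ M :=
  lift (fun m r => op r • m) (fun a b r => smul_add _ _ _)
    (fun m a b => by rw [MulOpposite.op_add, add_smul])
    (fun r m s => by rw [smul_eq_mul, op_mul, mul_smul])

/-- The isomorphism `R ⊗ N → N`, `r ⊗ n ↦ r n`. -/
def lid : R ⊗ᴮ[R] N →+ N :=
  lift (fun r n => r • n) (fun a b n => add_smul _ _ _) (fun r a b => smul_add _ _ _)
    (fun r m s => by rw [op_smul_eq_mul, mul_smul])

@[simp] theorem rid_tmul (m : M) (r : R) : rid (tmul R m r) = op r • m := rfl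

@[simp] theorem lid_tmul (r : R) (n : N) : lid (tmul R r n) = r • n := rfl

theorem rid_map (f : M →ₗ[Rᵐᵒᵖ] M') (z : M ⊗ᴮ[R] R) : rid (map f LinearMap.id z) = f (rid z) := by
  induction z using induction_on with
  | tm m r => rw [map_tmul, rid_tmul, rid_tmul, map_smul]; rfl
  | plus x y hx hy => simp only [map_add, hx, hy]

end BTensor

end BTensor

/-! ## Bimodule maps and corings -/

/-- The group of maps of `R`-`S` bimodules: additive, left `R`-linear and right `S`-linear. -/
def bimodHom (R S M N : Type*) [Ring R] [Ring S] [AddCommGroup M] [Module R M]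
    [Module Sᵐᵒᵖ M] [AddCommGroup N] [Module R N] [Module Sᵐᵒᵖ N] : AddSubgroup (M →+ N) where
  carrier := {f | (∀ (r : R) (m : M), f (r • m) = r • f m) ∧
    ∀ (s : S) (m : M), f (op s • m) = op s • f m}
  zero_mem' := ⟨fun r m => (smul_zero r).symm, fun s m => (smul_zero (op s)).symm⟩
  add_mem' {f g} hf hg := ⟨fun r m => by simp [hf.1, hg.1], fun s m => by simp [hf.2, hg.2]⟩
  neg_mem' {f} hf := ⟨fun r m => by simp [hf.1], fun s m => by simp [hf.2]⟩

/-- Maps of `R`-`S` bimodules. -/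
abbrev BimodHom (R S M N : Type*) [Ring R] [Ring S] [AddCommGroup M] [Module R M]
    [Module Sᵐᵒᵖ M] [AddCommGroup N] [Module R N] [Module Sᵐᵒᵖ N] : Type _ :=
  bimodHom R S M N

namespace BimodHom

variable {R S M N : Type*} [Ring R] [Ring S] [AddCommGroup M] [Module R M]
    [Module Sᵐᵒᵖ M] [AddCommGroup N] [Module R N] [Module Sᵐᵒᵖ N]

instance : CoeFun (BimodHom R S M N) (fun _ => M → N) := ⟨fun f => f.1⟩

/-- The underlying left linear map. -/
def l (f : BimodHom R S M N) : M →ₗ[R] N where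
  toFun := f
  map_add' := map_add f.1
  map_smul' := f.2.1

/-- The underlying right linear map. -/
def r (f : BimodHom R S M N) : M →ₗ[Sᵐᵒᵖ] N where
  toFun := f
  map_add' := map_add f.1
  map_smul' s m := f.2.2 s.unop m

@[simp] theorem l_apply (f : BimodHom R S M N) (m : M) : f.l m = f m := rfl

@[simp] theorem r_apply (f : BimodHom R S M N) (m : M) : f.r m = f m := rfl

/-- `BimodHom.l` as an additive map. -/
def lHom : BimodHom R S M N →+ (M →ₗ[R] N) := AddMonoidHom.mk' l (fun _ _ => rfl)

/-- `BimodHom.r` as an additive map. -/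
def rHom : BimodHom R S M N →+ (M →ₗ[Sᵐᵒᵖ] N) := AddMonoidHom.mk' r (fun _ _ => rfl)

end BimodHom

open BTensor

/-- An `A`-coring: an `A`-`A` bimodule `C` with a coassociative coproduct and a counit, both of
them `A`-`A` bilinear. -/
class Coring (A C : Type*) [Ring A] [AddCommGroup C] [Module A C] [Module Aᵐᵒᵖ C]
    [SMulCommClass A Aᵐᵒᵖ C] where
  comul : BimodHom A A C (C ⊗ᴮ[A] C)
  counit : BimodHom A A C A
  coassoc : ∀ c : C, assoc (map comul.r LinearMap.id (comul c)) =
    map LinearMap.id comul.l (comul c)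
  counit_comul : ∀ c : C, lid (map counit.r LinearMap.id (comul c)) = c
  comul_counit : ∀ c : C, rid (map LinearMap.id counit.l (comul c)) = c

section Comodules

variable (A C : Type u) [Ring A] [AddCommGroup C] [Module A C] [Module Aᵐᵒᵖ C]
  [SMulCommClass A Aᵐᵒᵖ C] [Coring A C]

/-- A right `C`-comodule for an `A`-coring `C`: a right `A`-module with a right `A`-linear,
coassociative and counital coaction. -/
structure RightComodule where
  carrier : Type u
  [addCommGroup : AddCommGroup carrier]
  [module : Module Aᵐᵒᵖ carrier]
  coact : carrier →ₗ[Aᵐᵒᵖ] carrier ⊗ᴮ[A] C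
  coassoc : ∀ m, assoc (map coact LinearMap.id (coact m)) =
    map LinearMap.id (Coring.comul (A := A) (C := C)).l (coact m)
  coact_counit : ∀ m, rid (map LinearMap.id (Coring.counit (A := A) (C := C)).l (coact m)) = m

namespace RightComodule

instance : CoeSort (RightComodule A C) (Type u) := ⟨carrier⟩

attribute [instance] addCommGroup module

variable {A C}

/-- `Hom^C(M, N)`: the right `A`-linear and right `C`-colinear maps from `M` to `N`. -/
def homC (M N : RightComodule A C) : AddSubgroup (M →ₗ[Aᵐᵒᵖ] N) where
  carrier := {f | ∀ m, N.coact (f m) = map f LinearMap.id (M.coact m)}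
  zero_mem' m := by
    rw [← mapLeftHom_apply, map_zero, LinearMap.zero_apply, map_zero]
  add_mem' {f g} hf hg m := by
    rw [← mapLeftHom_apply, map_add, LinearMap.add_apply, map_add, hf m, hg m]; rfl
  neg_mem' {f} hf m := by
    rw [← mapLeftHom_apply, map_neg, LinearMap.neg_apply, map_neg, hf m]; rfl

theorem mem_homC {M N : RightComodule A C} {f : M →ₗ[Aᵐᵒᵖ] N} :
    f ∈ homC M N ↔ ∀ m, N.coact (f m) = map f LinearMap.id (M.coact m) := Iff.rfl

theorem id_mem (M : RightComodule A C) : LinearMap.id ∈ homC M M := fun m => by simp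

theorem comp_mem {M N P : RightComodule A C} {g : N →ₗ[Aᵐᵒᵖ] P} {f : M →ₗ[Aᵐᵒᵖ] N}
    (hg : g ∈ homC N P) (hf : f ∈ homC M N) : g ∘ₗ f ∈ homC M P := fun m => by
  rw [LinearMap.comp_apply, hg, hf, map_map]; rfl

/-- The category of right `C`-comodules. -/
instance : Category (RightComodule A C) where
  Hom M N := homC M N
  id M := ⟨LinearMap.id, id_mem M⟩
  comp f g := ⟨g.1 ∘ₗ f.1, comp_mem g.2 f.2⟩

/-- The algebra `End^C(M)` of comodule endomorphisms, multiplied by composition. -/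
def endC (M : RightComodule A C) : Subring (Module.End Aᵐᵒᵖ M) where
  carrier := {f | f ∈ homC M M}
  zero_mem' := (homC M M).zero_mem
  one_mem' := id_mem M
  add_mem' := (homC M M).add_mem
  neg_mem' := (homC M M).neg_mem
  mul_mem' := comp_mem

instance (M : RightComodule A C) : Module M.endC M :=
  Module.compHom M M.endC.subtype

@[simp] theorem endC_smul (M : RightComodule A C) (t : M.endC) (x : M) : t • x = t.1 x := rfl

instance (M : RightComodule A C) : SMulCommClass M.endC Aᵐᵒᵖ M where
  smul_comm t a x := map_smul t.1 a x

end RightComodule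

open RightComodule

variable {A C}

/-! ## The functors `- ⊗_T Σ` and `Hom^C(Σ, -)`, where `T = End^C(Σ)` -/

/-- The coaction of a comodule is linear over its comodule endomorphisms. -/
def coactEnd (X : RightComodule A C) : X →ₗ[X.endC] X ⊗ᴮ[A] C where
  toFun := X.coact
  map_add' := map_add _
  map_smul' t x := by
    rw [endC_smul, t.2 x, RingHom.id_apply]
    generalize X.coact x = z
    induction z using BTensor.induction_on with
    | tm m n => rfl
    | plus x y hx hy => rw [map_add, smul_add, hx, hy]

@[simp] theorem coactEnd_apply (X : RightComodule A C) (x : X) : coactEnd X x = X.coact x := rfl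

/-- The map `x ↦ n ⊗ x`. -/
def tmulHom (X : RightComodule A C) (N : ModuleCat.{u} X.endCᵐᵒᵖ) (n : N) :
    X →ₗ[Aᵐᵒᵖ] N ⊗ᴮ[X.endC] X where
  toFun x := tmul X.endC n x
  map_add' := tmul_add n
  map_smul' _ _ := rfl

theorem ind_aux (X : RightComodule A C) (N : ModuleCat.{u} X.endCᵐᵒᵖ) (n : N)
    (w : X ⊗ᴮ[A] C) : assoc.symm (tmul X.endC n w) = map (tmulHom X N n) LinearMap.id w := by
  induction w using BTensor.induction_on with
  | tm y c => rfl
  | plus x y hx hy => rw [tmul_add, map_add, hx, hy, map_add]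

theorem ind_aux_smul (X : RightComodule A C) (N : ModuleCat.{u} X.endCᵐᵒᵖ) (a : Aᵐᵒᵖ)
    (z : N ⊗ᴮ[X.endC] X) :
    (assoc.symm (map LinearMap.id (coactEnd X) (a • z)) : (N ⊗ᴮ[X.endC] X) ⊗ᴮ[A] C) =
      a • assoc.symm (map LinearMap.id (coactEnd X) z) := by
  induction z using BTensor.induction_on with
  | tm n x =>
    rw [right_smul_tmul, map_tmul, map_tmul, coactEnd_apply, coactEnd_apply, map_smul, ind_aux,
      ind_aux]
    exact map_smul (mapR (tmulHom X N n) LinearMap.id (fun _ _ => rfl)) a _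
  | plus x y hx hy => rw [smul_add, map_add, map_add, map_add, map_add, smul_add, hx, hy]

/-- The coaction `n ⊗ x ↦ (n ⊗ x⁰) ⊗ x¹` of `N ⊗_T X`. -/
def indCoact (X : RightComodule A C) (N : ModuleCat.{u} X.endCᵐᵒᵖ) :
    N ⊗ᴮ[X.endC] X →ₗ[Aᵐᵒᵖ] (N ⊗ᴮ[X.endC] X) ⊗ᴮ[A] C where
  toFun z := assoc.symm (map LinearMap.id (coactEnd X) z)
  map_add' a b := by rw [map_add, map_add]
  map_smul' a z := ind_aux_smul X N a z

theorem indCoact_tmul (X : RightComodule A C) (N : ModuleCat.{u} X.endCᵐᵒᵖ) (n : N) (x : X) :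
    indCoact X N (tmul X.endC n x) = map (tmulHom X N n) LinearMap.id (X.coact x) :=
  ind_aux X N n (X.coact x)

theorem indCoact_map (X : RightComodule A C) {N N' : ModuleCat.{u} X.endCᵐᵒᵖ} (f : N ⟶ N')
    (z : N ⊗ᴮ[X.endC] X) :
    indCoact X N' (map f.hom LinearMap.id z) =
      map (mapR f.hom (LinearMap.id : X →ₗ[X.endC] X) (S := A) (fun _ _ => rfl)) LinearMap.id
        (indCoact X N z) := by
  induction z using BTensor.induction_on with
  | tm n x =>
    rw [map_tmul, indCoact_tmul, indCoact_tmul, map_map]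
    rfl
  | plus x y hx hy => simp only [map_add, hx, hy]

/-- The right `C`-comodule `N ⊗_T X`. -/
def indObj (X : RightComodule A C) (N : ModuleCat.{u} X.endCᵐᵒᵖ) : RightComodule A C where
  carrier := N ⊗ᴮ[X.endC] X
  coact := indCoact X N
  coassoc z := by
    induction z using BTensor.induction_on with
    | tm n x =>
      rw [indCoact_tmul, map_map]
      have h : indCoact X N ∘ₗ tmulHom X N n =
          mapR (tmulHom X N n) (LinearMap.id : C →ₗ[A] C) (S := A) (fun _ _ => rfl) ∘ₗ
            X.coact := LinearMap.ext fun x => indCoact_tmul X N n x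
      rw [h, map_map, ← map_map _ LinearMap.id X.coact LinearMap.id, assoc_map_left, X.coassoc,
        map_map]
      rfl
    | plus x y hx hy => simp only [map_add, hx, hy]
  coact_counit z := by
    induction z using BTensor.induction_on with
    | tm n x =>
      rw [indCoact_tmul, map_map, LinearMap.id_comp, LinearMap.comp_id,
        ← LinearMap.id_comp (Coring.counit (A := A) (C := C)).l, ← LinearMap.comp_id (tmulHom X N n),
        ← map_map, rid_map, X.coact_counit]
      rfl
    | plus x y hx hy => simp only [map_add, hx, hy]

/-- The functor `- ⊗_T X` from right `T`-modules to right `C`-comodules. -/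
def indFunctor (X : RightComodule A C) : ModuleCat.{u} X.endCᵐᵒᵖ ⥤ RightComodule A C where
  obj N := indObj X N
  map f := ⟨mapR f.hom LinearMap.id (fun _ _ => rfl), indCoact_map X f⟩
  map_id N := Subtype.ext (LinearMap.ext fun z => map_id z)
  map_comp f g := Subtype.ext (LinearMap.ext fun z =>
    (map_map g.hom LinearMap.id f.hom LinearMap.id z).symm)

instance (X M : RightComodule A C) : Module X.endCᵐᵒᵖ (homC X M) where
  smul t f := ⟨f.1 ∘ₗ t.unop.1, comp_mem f.2 t.unop.2⟩
  one_smul f := rfl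
  mul_smul s t f := rfl
  smul_zero t := rfl
  smul_add t f g := rfl
  add_smul s t f := Subtype.ext (LinearMap.comp_add _ _ f.1)
  zero_smul f := Subtype.ext (LinearMap.comp_zero f.1)

/-- `Hom^C(X, M)` is a right module over `End^C(X)` by composition. -/
theorem homC_smul (X M : RightComodule A C) (t : X.endC) (f : homC X M) (x : X) :
    (op t • f).1 x = f.1 (t.1 x) := rfl

/-- The functor `Hom^C(X, -)` from right `C`-comodules to right `T`-modules. -/
def coinvFunctor (X : RightComodule A C) : RightComodule A C ⥤ ModuleCat.{u} X.endCᵐᵒᵖ where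
  obj M := ModuleCat.of X.endCᵐᵒᵖ (homC X M)
  map {M M'} f := ModuleCat.ofHom
    { toFun := fun g => ⟨f.1 ∘ₗ g.1, comp_mem f.2 g.2⟩
      map_add' := fun g h => Subtype.ext (LinearMap.comp_add _ _ f.1)
      map_smul' := fun t g => rfl }
  map_id M := rfl
  map_comp f g := rfl

end Comodules

/-! ## Right coring extensions and purity -/

section Extensions

open RightComodule

/-- The coproduct of the `A`-coring `C` is right `L`-linear for a right `L`-action on `C` that
commutes with the left `A`-action. -/
class ComulRightLinear (A C L : Type*) [Ring A] [AddCommGroup C] [Module A C] [Module Aᵐᵒᵖ C]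
    [SMulCommClass A Aᵐᵒᵖ C] [Coring A C] [Ring L] [Module Lᵐᵒᵖ C] [SMulCommClass A Lᵐᵒᵖ C] :
    Prop where
  comul_smul : ∀ (l : Lᵐᵒᵖ) (c : C),
    Coring.comul (A := A) (l • c) = l • Coring.comul (A := A) c

/-- The coproduct of `C` as a right `L`-linear map. -/
def comulR (A C L : Type*) [Ring A] [AddCommGroup C] [Module A C] [Module Aᵐᵒᵖ C]
    [SMulCommClass A Aᵐᵒᵖ C] [Coring A C] [Ring L] [Module Lᵐᵒᵖ C] [SMulCommClass A Lᵐᵒᵖ C]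
    [ComulRightLinear A C L] : C →ₗ[Lᵐᵒᵖ] C ⊗ᴮ[A] C where
  toFun := Coring.comul (A := A) (C := C)
  map_add' := map_add (Coring.comul (A := A) (C := C)).1
  map_smul' := ComulRightLinear.comul_smul

/-- The `L`-coring `D` is a right extension of the `A`-coring `C`: `C` is a `C`-`D` bicomodule
with its regular left coaction, that is, there is a left `A`-linear right `D`-coaction `tau` on `C`
such that the coproduct of `C` is right `D`-colinear. -/
class RightExtension (A C L D : Type*) [Ring A] [AddCommGroup C] [Module A C] [Module Aᵐᵒᵖ C]
    [SMulCommClass A Aᵐᵒᵖ C] [Coring A C] [Ring L] [Module Lᵐᵒᵖ C] [SMulCommClass A Lᵐᵒᵖ C]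
    [ComulRightLinear A C L] [AddCommGroup D] [Module L D] [Module Lᵐᵒᵖ D]
    [SMulCommClass L Lᵐᵒᵖ D] [Coring L D] where
  tau : BimodHom A L C (C ⊗ᴮ[L] D)
  coassoc : ∀ c : C, assoc (map tau.r LinearMap.id (tau c)) =
    map LinearMap.id (Coring.comul (A := L) (C := D)).l (tau c)
  tau_counit : ∀ c : C, rid (map LinearMap.id (Coring.counit (A := L) (C := D)).l (tau c)) = c
  comul_colinear : ∀ c : C, assoc (map (comulR A C L) LinearMap.id (tau c)) =
    map LinearMap.id tau.l (Coring.comul (A := A) c)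

variable {A C L D : Type u} [Ring A] [AddCommGroup C] [Module A C] [Module Aᵐᵒᵖ C]
  [SMulCommClass A Aᵐᵒᵖ C] [Coring A C] [Ring L] [Module Lᵐᵒᵖ C] [SMulCommClass A Lᵐᵒᵖ C]
  [ComulRightLinear A C L]

/-- The map `m ⊗ c ↦ m g(c)`. -/
def ev {M : Type*} [AddCommGroup M] [Module Aᵐᵒᵖ M] (g : C →ₗ[A] A) : M ⊗ᴮ[A] C →+ M :=
  rid.comp (map LinearMap.id g)

@[simp] theorem ev_tmul {M : Type*} [AddCommGroup M] [Module Aᵐᵒᵖ M] (g : C →ₗ[A] A) (m : M)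
    (c : C) : ev g (tmul A m c) = op (g c) • m := rfl

theorem ev_map {M M' : Type*} [AddCommGroup M] [Module Aᵐᵒᵖ M] [AddCommGroup M'] [Module Aᵐᵒᵖ M']
    (g : C →ₗ[A] A) (f : M →ₗ[Aᵐᵒᵖ] M') (w : M ⊗ᴮ[A] C) :
    f (ev g w) = ev g (map f LinearMap.id w) := by
  induction w using BTensor.induction_on with
  | tm m c => simp
  | plus x y hx hy => simp only [map_add, hx, hy]

theorem ev_assoc_symm {M : Type*} [AddCommGroup M] [Module Aᵐᵒᵖ M] (g : C →ₗ[A] A) (m : M)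
    (u : C ⊗ᴮ[A] C) : ev g (assoc.symm (tmul A m u)) = tmul A m (ev g u) := by
  induction u using BTensor.induction_on with
  | tm x y => rfl
  | plus x y hx hy => simp only [tmul_add, map_add, hx, hy]

theorem ev_coact_coact (g : C →ₗ[A] A) (M : RightComodule A C) (m : M) :
    M.coact (ev g (M.coact m)) =
      ev g (assoc.symm (map LinearMap.id (Coring.comul (A := A) (C := C)).l (M.coact m))) := by
  rw [ev_map, ← M.coassoc, AddEquiv.symm_apply_apply]

/-- The counit of `C` as a left linear map. -/
abbrev counitL (A C : Type*) [Ring A] [AddCommGroup C] [Module A C] [Module Aᵐᵒᵖ C]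
    [SMulCommClass A Aᵐᵒᵖ C] [Coring A C] : C →ₗ[A] A := (Coring.counit (A := A) (C := C)).l

theorem coact_ev_counit (M : RightComodule A C) (l : Lᵐᵒᵖ) (m : M) :
    M.coact (ev (counitL A C) (l • M.coact m)) = l • M.coact m := by
  have h1 : map M.coact LinearMap.id (l • M.coact m) =
      l • assoc.symm (map LinearMap.id (Coring.comul (A := A) (C := C)).l (M.coact m)) := by
    rw [← M.coassoc, AddEquiv.symm_apply_apply]
    exact map_smul (mapR M.coact (LinearMap.id : C →ₗ[A] C) (fun _ _ => rfl)) l (M.coact m)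
  rw [ev_map, h1]
  generalize M.coact m = w
  induction w using BTensor.induction_on with
  | tm m c =>
    have h2 : ∀ u : C ⊗ᴮ[A] C, ev (counitL A C) (l • assoc.symm (tmul A m u)) =
        tmul A m (ev (counitL A C) (l • u)) := fun u => by
      induction u using BTensor.induction_on with
      | tm x y => rfl
      | plus x y hx hy => simp only [tmul_add, map_add, smul_add, hx, hy]
    rw [map_tmul, LinearMap.id_apply, h2, right_smul_tmul, BimodHom.l_apply,
      ← ComulRightLinear.comul_smul]
    exact congrArg (tmul A m) (Coring.comul_counit (l • c))
  | plus x y hx hy => simp only [map_add, smul_add, hx, hy]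

/-- The right `L`-action `m l = m⁰ ε(m¹ l)` on a right `C`-comodule. -/
instance inducedModule (M : RightComodule A C) : Module Lᵐᵒᵖ M where
  smul l m := ev (counitL A C) (l • M.coact m)
  one_smul m := by
    change ev (counitL A C) ((1 : Lᵐᵒᵖ) • M.coact m) = m
    rw [one_smul]
    exact M.coact_counit m
  mul_smul s t m := by
    change ev (counitL A C) ((s * t) • M.coact m) =
      ev (counitL A C) (s • M.coact (ev (counitL A C) (t • M.coact m)))
    rw [coact_ev_counit, mul_smul]
  smul_zero s := by
    change ev (counitL A C) (s • M.coact 0) = 0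
    rw [map_zero, smul_zero, map_zero]
  smul_add s m m' := by
    change ev (counitL A C) (s • M.coact (m + m')) =
      ev (counitL A C) (s • M.coact m) + ev (counitL A C) (s • M.coact m')
    rw [map_add, smul_add, map_add]
  add_smul s t m := by
    change ev (counitL A C) ((s + t) • M.coact m) =
      ev (counitL A C) (s • M.coact m) + ev (counitL A C) (t • M.coact m)
    rw [add_smul, map_add]
  zero_smul m := by
    change ev (counitL A C) ((0 : Lᵐᵒᵖ) • M.coact m) = 0
    rw [zero_smul, map_zero]

theorem induced_smul (M : RightComodule A C) (l : Lᵐᵒᵖ) (m : M) :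
    l • m = ev (counitL A C) (l • M.coact m) := rfl

variable (L) in
/-- The coaction `M → M ⊗ C` as a right `L`-linear map. -/
def coactL (M : RightComodule A C) : M →ₗ[Lᵐᵒᵖ] M ⊗ᴮ[A] C where
  toFun := M.coact
  map_add' := map_add _
  map_smul' l m := coact_ev_counit M l m

variable (L) in
/-- The map `m ⊗ c ↦ m⁰ ⊗ (m¹ ⊗ c)` as a right `L`-linear map. -/
def coactTensor (M : RightComodule A C) : M ⊗ᴮ[A] C →ₗ[Lᵐᵒᵖ] M ⊗ᴮ[A] (C ⊗ᴮ[A] C) where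
  toFun z := assoc (map M.coact LinearMap.id z)
  map_add' x y := by rw [map_add, map_add]
  map_smul' l z := by
    induction z using BTensor.induction_on with
    | tm m c =>
      rw [right_smul_tmul, map_tmul, map_tmul, RingHom.id_apply]
      generalize M.coact m = w
      induction w using BTensor.induction_on with
      | tm y c => rfl
      | plus x y hx hy =>
        simp only [LinearMap.id_apply, add_tmul, map_add, smul_add] at hx hy ⊢
        rw [hx, hy]
    | plus x y hx hy => simp only [map_add, smul_add, hx, hy]

variable (L) in
/-- The map `m ⊗ c ↦ m ⊗ (c₁ ⊗ c₂)` as a right `L`-linear map. -/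
def tensorComul (M : RightComodule A C) : M ⊗ᴮ[A] C →ₗ[Lᵐᵒᵖ] M ⊗ᴮ[A] (C ⊗ᴮ[A] C) :=
  mapR LinearMap.id (Coring.comul (A := A) (C := C)).l ComulRightLinear.comul_smul

/-- The functor `- ⊗_L X` preserves the equaliser `M → M ⊗ C ⇉ M ⊗ C ⊗ C`: the map `ϱ ⊗ X` is
injective, with image the equaliser of `ϱ ⊗ C ⊗ X` and `M ⊗ Δ ⊗ X`. -/
def PreservesCoactEqualiser (M : RightComodule A C) (X : Type u) [AddCommGroup X] [Module L X] :
    Prop :=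
  Function.Injective (map (coactL L M) (LinearMap.id : X →ₗ[L] X)) ∧
  ∀ z : (M ⊗ᴮ[A] C) ⊗ᴮ[L] X,
    map (coactTensor L M) LinearMap.id z = map (tensorComul L M) LinearMap.id z →
      ∃ y, map (coactL L M) LinearMap.id y = z

variable [AddCommGroup D] [Module L D] [Module Lᵐᵒᵖ D] [SMulCommClass L Lᵐᵒᵖ D] [Coring L D]

variable (A C L D) in
/-- The right coring extension `D` of `C` is pure: the defining equaliser of every right
`C`-comodule is preserved by `- ⊗_L D ⊗_L D`. -/
def IsPure : Prop := ∀ M : RightComodule A C, PreservesCoactEqualiser (L := L) M (D ⊗ᴮ[L] D)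

/-- The map `d ⊗ d' ↦ ε(d) d'`. -/
def counitTensor (L D : Type*) [Ring L] [AddCommGroup D] [Module L D] [Module Lᵐᵒᵖ D]
    [SMulCommClass L Lᵐᵒᵖ D] [Coring L D] : D ⊗ᴮ[L] D →ₗ[L] D where
  toFun z := lid (map (Coring.counit (A := L) (C := D)).r LinearMap.id z)
  map_add' x y := by rw [map_add, map_add]
  map_smul' l z := by
    induction z using BTensor.induction_on with
    | tm d d' =>
      rw [left_smul_tmul, map_tmul, map_tmul, BimodHom.r_apply,
        (Coring.counit (A := L) (C := D)).2.1]
      exact mul_smul _ _ _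
    | plus x y hx hy => simp only [map_add, smul_add, hx, hy]

theorem IsPure.preserves (h : IsPure A C L D) (M : RightComodule A C) :
    PreservesCoactEqualiser (L := L) M D := by
  have hc : counitTensor L D ∘ₗ (Coring.comul (A := L) (C := D)).l = LinearMap.id :=
    LinearMap.ext fun d => Coring.counit_comul (A := L) d
  have swap : ∀ {X Y : Type u} [AddCommGroup X] [Module Lᵐᵒᵖ X] [AddCommGroup Y] [Module Lᵐᵒᵖ Y]
      {V W : Type u} [AddCommGroup V] [Module L V] [AddCommGroup W] [Module L W]
      (f : X →ₗ[Lᵐᵒᵖ] Y) (g : V →ₗ[L] W) (z : X ⊗ᴮ[L] V),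
      map LinearMap.id g (map f LinearMap.id z) = map f LinearMap.id (map LinearMap.id g z) := by
    intros
    rw [map_map, map_map]
    rfl
  have ret : ∀ {X : Type u} [AddCommGroup X] [Module Lᵐᵒᵖ X] (z : X ⊗ᴮ[L] D),
      map LinearMap.id (counitTensor L D)
        (map LinearMap.id (Coring.comul (A := L) (C := D)).l z) = z := by
    intro X _ _ z
    rw [map_map, hc, LinearMap.id_comp, map_id]
  obtain ⟨h1, h2⟩ := h M
  constructor
  · intro y y' hy
    have h3 := congrArg (map LinearMap.id (Coring.comul (A := L) (C := D)).l) hy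
    rw [swap, swap] at h3
    rw [← ret y, h1 h3, ret y']
  · intro z hz
    obtain ⟨y, hy⟩ := h2 (map LinearMap.id (Coring.comul (A := L) (C := D)).l z) (by
      rw [← swap, hz, swap])
    exact ⟨map LinearMap.id (counitTensor L D) y, by rw [← swap, hy, ret]⟩

/-- The associator `(M ⊗ C) ⊗ C → M ⊗ (C ⊗ C)` as a right `L`-linear map. -/
def assocR (L : Type u) [Ring L] [Module Lᵐᵒᵖ C] [SMulCommClass A Lᵐᵒᵖ C] (M : RightComodule A C) :
    (M ⊗ᴮ[A] C) ⊗ᴮ[A] C →ₗ[Lᵐᵒᵖ] M ⊗ᴮ[A] (C ⊗ᴮ[A] C) where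
  toFun z := assoc z
  map_add' := map_add _
  map_smul' l z := by
    induction z using BTensor.induction_on with
    | tm w c =>
      induction w using BTensor.induction_on with
      | tm m c' => rfl
      | plus x y hx hy => simp only [add_tmul, map_add, smul_add, hx, hy]
    | plus x y hx hy => simp only [map_add, smul_add, hx, hy]

/-- The map `u ↦ m ⊗ u` as a right `L`-linear map. -/
def tmulR (L : Type u) [Ring L] [Module Lᵐᵒᵖ C] [SMulCommClass A Lᵐᵒᵖ C] (M : RightComodule A C)
    (m : M) : C ⊗ᴮ[A] C →ₗ[Lᵐᵒᵖ] M ⊗ᴮ[A] (C ⊗ᴮ[A] C) where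
  toFun u := tmul A m u
  map_add' := tmul_add m
  map_smul' _ _ := rfl

variable [RightExtension A C L D]

variable (A C L D) in
/-- The right `D`-coaction of `C` as a left `A`-linear map. -/
abbrev tauL : C →ₗ[A] C ⊗ᴮ[L] D := (RightExtension.tau (A := A) (C := C) (L := L) (D := D)).l

theorem tau_mem_equaliser (M : RightComodule A C) (m : M) :
    map (coactTensor L M) LinearMap.id
      (assoc.symm (map LinearMap.id (tauL A C L D) (M.coact m))) =
    map (tensorComul L M) LinearMap.id
      (assoc.symm (map LinearMap.id (tauL A C L D) (M.coact m))) := by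
  have h1 : ∀ t : M ⊗ᴮ[A] C, map (coactTensor L M) LinearMap.id
      (assoc.symm (map LinearMap.id (tauL A C L D) t)) =
      map (assocR L M) LinearMap.id (assoc.symm
        (map LinearMap.id (tauL A C L D) (map M.coact LinearMap.id t))) := fun t => by
    induction t using BTensor.induction_on with
    | tm m c =>
      simp only [map_tmul, LinearMap.id_apply]
      generalize tauL A C L D c = v
      induction v using BTensor.induction_on with
      | tm c' d =>
        simp only [assoc_symm_tmul, map_tmul, LinearMap.id_apply]
        rfl
      | plus x y hx hy => simp only [tmul_add, map_add, hx, hy]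
    | plus x y hx hy => simp only [map_add, hx, hy]
  have h2 : ∀ (m : M) (u : C ⊗ᴮ[A] C), map (assocR L M) LinearMap.id (assoc.symm
      (map LinearMap.id (tauL A C L D) (assoc.symm (tmul A m u)))) =
      map (tmulR L M m) LinearMap.id (assoc.symm (map LinearMap.id (tauL A C L D) u)) :=
    fun m u => by
    induction u using BTensor.induction_on with
    | tm c c' =>
      simp only [map_tmul, LinearMap.id_apply, assoc_symm_tmul]
      generalize tauL A C L D c' = v
      induction v using BTensor.induction_on with
      | tm c'' d => rfl
      | plus x y hx hy => simp only [tmul_add, map_add, hx, hy]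
    | plus x y hx hy => simp only [tmul_add, map_add, hx, hy]
  have h3 : map M.coact LinearMap.id (M.coact m) =
      assoc.symm (map LinearMap.id (Coring.comul (A := A) (C := C)).l (M.coact m)) := by
    rw [← M.coassoc, AddEquiv.symm_apply_apply]
  rw [h1, h3]
  generalize M.coact m = w
  induction w using BTensor.induction_on with
  | tm m c =>
    rw [map_tmul, LinearMap.id_apply, h2, map_tmul, LinearMap.id_apply, BimodHom.l_apply]
    rw [← RightExtension.comul_colinear (A := A) (L := L) (D := D) c, AddEquiv.symm_apply_apply,
      BimodHom.l_apply]
    generalize (RightExtension.tau (A := A) (L := L) (D := D)) c = v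
    induction v using BTensor.induction_on with
    | tm c d => rfl
    | plus x y hx hy => simp only [tmul_add, map_add, hx, hy]
  | plus x y hx hy => simp only [map_add, hx, hy]

theorem exists_coactD (h : IsPure A C L D) (M : RightComodule A C) (m : M) :
    ∃ y : M ⊗ᴮ[L] D, map (coactL L M) LinearMap.id y =
      assoc.symm (map LinearMap.id (tauL A C L D) (M.coact m)) :=
  (h.preserves M).2 _ (tau_mem_equaliser M m)

/-- The right `D`-coaction of a right `C`-comodule `M`, obtained from `M ≅ M □_C C`: it is the
unique map `M → M ⊗_L D` whose composite with the injective map `ϱ ⊗ D` is `(M ⊗ τ) ϱ`. -/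
def coactD (h : IsPure A C L D) (M : RightComodule A C) : M →+ M ⊗ᴮ[L] D :=
  AddMonoidHom.mk' (fun m => (exists_coactD h M m).choose) (fun m m' => by
    apply (h.preserves M).1
    refine (exists_coactD h M (m + m')).choose_spec.trans ?_
    rw [map_add, map_add, map_add, map_add, (exists_coactD h M m).choose_spec,
      (exists_coactD h M m').choose_spec])

theorem coactD_spec (h : IsPure A C L D) (M : RightComodule A C) (m : M) :
    map (coactL L M) LinearMap.id (coactD h M m) =
      assoc.symm (map LinearMap.id (tauL A C L D) (M.coact m)) :=
  (exists_coactD h M m).choose_spec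

/-! ## The Morita context of a bicomodule -/

/-- A right `C`-comodule `X` with a left `L`-action is an `L`-`C` bicomodule: the coaction is left
`L`-linear. -/
class Bicomodule (L : Type u) [Ring L] (X : RightComodule A C) [Module L X]
    [SMulCommClass L Aᵐᵒᵖ X] : Prop where
  coact_smul : ∀ (l : L) (x : X), X.coact (l • x) = l • X.coact x

variable (X : RightComodule A C) [Module L X] [SMulCommClass L Aᵐᵒᵖ X] [Bicomodule L X]

variable (L) in
/-- The unit map `L → T`, `l ↦ (x ↦ l x)`, of the `L`-ring `T = End^C(X)`. -/
def unitMap : L →+* X.endC where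
  toFun l := ⟨smulHom Aᵐᵒᵖ l, fun x => Bicomodule.coact_smul l x⟩
  map_one' := Subtype.ext (LinearMap.ext fun x => one_smul L x)
  map_mul' l l' := Subtype.ext (LinearMap.ext fun x => mul_smul l l' x)
  map_zero' := Subtype.ext (LinearMap.ext fun x => zero_smul L x)
  map_add' l l' := Subtype.ext (LinearMap.ext fun x => add_smul l l' x)

/-- The left `L`-action on `T`. -/
instance endLeft : Module L X.endC := Module.compHom X.endC (unitMap L X)

/-- The right `L`-action on `T`. -/
instance endRight : Module Lᵐᵒᵖ X.endC := Module.compHom X.endC (unitMap L X).op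

theorem end_smul (l : L) (t : X.endC) : l • t = unitMap L X l * t := rfl

theorem end_op_smul (l : L) (t : X.endC) : op l • t = t * unitMap L X l := rfl

/-- The dual `X* = Hom_A(X, A)`, a left `A`-module by `(a ξ)(x) = a ξ(x)`. -/
abbrev dual (X : RightComodule A C) : Type u := X →ₗ[Aᵐᵒᵖ] A

/-- The right `L`-action `(ξ l)(x) = ξ(l x)` on the dual. -/
instance dualRight : Module Lᵐᵒᵖ (dual X) where
  smul l ξ := ξ ∘ₗ smulHom Aᵐᵒᵖ l.unop
  one_smul ξ := LinearMap.ext fun x => congrArg ξ (one_smul L x)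
  mul_smul l l' ξ := LinearMap.ext fun x => congrArg ξ (mul_smul l'.unop l.unop x)
  smul_zero l := rfl
  smul_add l ξ ξ' := rfl
  add_smul l l' ξ := LinearMap.ext fun x =>
    (congrArg ξ (add_smul l.unop l'.unop x)).trans (map_add ξ _ _)
  zero_smul ξ := LinearMap.ext fun x => (congrArg ξ (zero_smul L x)).trans (map_zero ξ)

theorem dual_smul (l : L) (ξ : dual X) (x : X) : (op l • ξ) x = ξ (l • x) := rfl

/-- The map `x ⊗ n ↦ ξ(x) n`. -/
def evDual {X : RightComodule A C} {N : Type*} [AddCommGroup N] [Module A N] (ξ : dual X) :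
    X ⊗ᴮ[A] N →+ N :=
  lid.comp (map ξ LinearMap.id)

/-- `ev` as an additive function of the functional. -/
def evHom {M : Type*} [AddCommGroup M] [Module Aᵐᵒᵖ M] (w : M ⊗ᴮ[A] C) : (C →ₗ[A] A) →+ M :=
  rid.comp (mapRightHom LinearMap.id w)

/-- `evDual` as an additive function of the functional. -/
def evDualHom {X : RightComodule A C} {N : Type*} [AddCommGroup N] [Module A N]
    (w : X ⊗ᴮ[A] N) : dual X →+ N :=
  lid.comp (mapLeftHom LinearMap.id w)

/-- For `q : C → X*` and `x ∈ X`, the map `c ↦ q(c)(x)`. -/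
def atPoint {X : RightComodule A C} (q : C →ₗ[A] dual X) (x : X) : C →ₗ[A] A where
  toFun c := q c x
  map_add' c c' := by rw [map_add]; rfl
  map_smul' a c := by rw [map_smul]; rfl

/-- `q ↦ q(-)(x)` as an additive map. -/
def atPointHom (L : Type u) [Ring L] [Module Lᵐᵒᵖ C] {X : RightComodule A C} [Module L X]
    [SMulCommClass L Aᵐᵒᵖ X] (x : X) : BimodHom A L C (dual X) →+ (C →ₗ[A] A) :=
  AddMonoidHom.mk' (fun q => atPoint q.l x) (fun _ _ => rfl)

/-- The group `Q̃` of the `A`-`L` bimodule maps `q : C → X*` such that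
`c₁ q(c₂)(x) = q(c)(x⁰) x¹` for all `x` and `c`. -/
def QTilde (L : Type u) [Ring L] [Module Lᵐᵒᵖ C] (X : RightComodule A C) [Module L X]
    [SMulCommClass L Aᵐᵒᵖ X] : AddSubgroup (BimodHom A L C (dual X)) where
  carrier := {q | ∀ (x : X) (c : C),
    ev (atPoint q.l x) (Coring.comul (A := A) c) = evDual (q c) (X.coact x)}
  zero_mem' x c := (map_zero ((evHom (Coring.comul (A := A) c)).comp (atPointHom L x))).trans
    (map_zero (evDualHom (X.coact x))).symm
  add_mem' {q q'} hq hq' x c :=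
    (map_add ((evHom (Coring.comul (A := A) c)).comp (atPointHom L x)) q q').trans
      ((congrArg₂ (· + ·) (hq x c) (hq' x c)).trans
        (map_add (evDualHom (X.coact x)) (q c) (q' c)).symm)
  neg_mem' {q} hq x c :=
    (map_neg ((evHom (Coring.comul (A := A) c)).comp (atPointHom L x)) q).trans
      ((congrArg Neg.neg (hq x c)).trans (map_neg (evDualHom (X.coact x)) (q c)).symm)

/-- The group `_L Hom^D(D, X)` of left `L`-linear and right `D`-colinear maps. -/
def homD (h : IsPure A C L D) (X : RightComodule A C) [Module L X] :
    AddSubgroup (BimodHom L L D X) where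
  carrier := {p | ∀ d, coactD h X (p d) =
    map p.r LinearMap.id (Coring.comul (A := L) (C := D) d)}
  zero_mem' d := (map_zero (coactD h X)).trans (map_zero ((mapLeftHom LinearMap.id
    (Coring.comul (A := L) (C := D) d)).comp BimodHom.rHom)).symm
  add_mem' {p p'} hp hp' d := (map_add (coactD h X) (p d) (p' d)).trans
    ((congrArg₂ (· + ·) (hp d) (hp' d)).trans (map_add ((mapLeftHom LinearMap.id
      (Coring.comul (A := L) (C := D) d)).comp BimodHom.rHom) p p').symm)
  neg_mem' {p} hp d := (map_neg (coactD h X) (p d)).trans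
    ((congrArg Neg.neg (hp d)).trans (map_neg ((mapLeftHom LinearMap.id
      (Coring.comul (A := L) (C := D) d)).comp BimodHom.rHom) p).symm)

variable (A C L D) in
/-- The group `^C End^D(C)` of left `C`-colinear and right `D`-colinear endomorphisms of `C`. -/
def endCD : AddSubgroup (BimodHom A L C C) where
  carrier := {u | (∀ c, Coring.comul (A := A) (u c) =
      map LinearMap.id u.l (Coring.comul (A := A) c)) ∧
    ∀ c, tauL A C L D (u c) = map u.r LinearMap.id (tauL A C L D c)}
  zero_mem' := ⟨fun c => (map_zero (Coring.comul (A := A) (C := C)).1).trans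
      (map_zero ((mapRightHom LinearMap.id (Coring.comul (A := A) c)).comp BimodHom.lHom)).symm,
    fun c => (map_zero (tauL A C L D)).trans
      (map_zero ((mapLeftHom LinearMap.id (tauL A C L D c)).comp BimodHom.rHom)).symm⟩
  add_mem' {u u'} hu hu' := ⟨fun c => (map_add (Coring.comul (A := A) (C := C)).1 (u c) (u' c)).trans
      ((congrArg₂ (· + ·) (hu.1 c) (hu'.1 c)).trans (map_add ((mapRightHom LinearMap.id
        (Coring.comul (A := A) c)).comp BimodHom.lHom) u u').symm),
    fun c => (map_add (tauL A C L D) (u c) (u' c)).trans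
      ((congrArg₂ (· + ·) (hu.2 c) (hu'.2 c)).trans (map_add ((mapLeftHom LinearMap.id
        (tauL A C L D c)).comp BimodHom.rHom) u u').symm)⟩
  neg_mem' {u} hu := ⟨fun c => (map_neg (Coring.comul (A := A) (C := C)).1 (u c)).trans
      ((congrArg Neg.neg (hu.1 c)).trans (map_neg ((mapRightHom LinearMap.id
        (Coring.comul (A := A) c)).comp BimodHom.lHom) u).symm),
    fun c => (map_neg (tauL A C L D) (u c)).trans
      ((congrArg Neg.neg (hu.2 c)).trans (map_neg ((mapLeftHom LinearMap.id
        (tauL A C L D c)).comp BimodHom.rHom) u).symm)⟩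

/-- The right `A`-linear map `x ↦ m q(c)(x)`, summed over `w = m ⊗ c`. -/
def actLinAux {X : RightComodule A C} {M : Type*} [AddCommGroup M] [Module Aᵐᵒᵖ M]
    (q : C →ₗ[A] dual X) (w : M ⊗ᴮ[A] C) : X →ₗ[Aᵐᵒᵖ] M where
  toFun x := ev (atPoint q x) w
  map_add' x y := by
    induction w using BTensor.induction_on with
    | tm m c =>
      change op (q c (x + y)) • m = op (q c x) • m + op (q c y) • m
      rw [map_add, MulOpposite.op_add, add_smul]
    | plus v w hv hw => rw [map_add, map_add, map_add, hv, hw]; abel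
  map_smul' a x := by
    induction w using BTensor.induction_on with
    | tm m c =>
      change op (q c (a • x)) • m = a • op (q c x) • m
      rw [map_smul, ← mul_smul]
      rfl
    | plus v w hv hw => rw [map_add, map_add, hv, hw, RingHom.id_apply, smul_add]

/-- `actLinAux` as an additive map. -/
def actLin {X : RightComodule A C} {M : Type*} [AddCommGroup M] [Module Aᵐᵒᵖ M]
    (q : C →ₗ[A] dual X) : M ⊗ᴮ[A] C →+ (X →ₗ[Aᵐᵒᵖ] M) :=
  AddMonoidHom.mk' (actLinAux q)
    (fun v w => LinearMap.ext fun x => map_add (ev (atPoint q x)) v w)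

@[simp] theorem actLin_apply {X : RightComodule A C} {M : Type*} [AddCommGroup M] [Module Aᵐᵒᵖ M]
    (q : C →ₗ[A] dual X) (w : M ⊗ᴮ[A] C) (x : X) : actLin q w x = ev (atPoint q x) w := rfl

theorem actLin_mem (q : QTilde L X) (M : RightComodule A C) (m : M) :
    actLin q.1.l (M.coact m) ∈ homC X M := fun x => by
  rw [actLin_apply, ev_coact_coact]
  generalize M.coact m = w
  induction w using BTensor.induction_on with
  | tm m c =>
    rw [map_tmul, LinearMap.id_apply, ev_assoc_symm, BimodHom.l_apply, q.2 x c]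
    generalize X.coact x = v
    induction v using BTensor.induction_on with
    | tm y c' => exact (smul_tmul (q.1 c y) m c').symm
    | plus v w hv hw => rw [map_add, map_add, tmul_add, hv, hw]
  | plus v w hv hw =>
    rw [map_add, map_add, map_add, map_add, hv, hw]
    exact (map_add_left _ _ LinearMap.id (X.coact x)).symm

/-- The map `m ↦ m q(-)` from `M` to `Hom^C(X, M)`, where `(m q(-))(x) = m⁰ q(m¹)(x)`. -/
def actQ (q : QTilde L X) (M : RightComodule A C) : M →+ homC X M :=
  AddMonoidHom.mk' (fun m => ⟨actLin q.1.l (M.coact m), actLin_mem X q M m⟩)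
    (fun m m' => Subtype.ext (map_add ((actLin q.1.l).comp M.coact.toAddMonoidHom) m m'))

theorem actQ_apply (q : QTilde L X) (M : RightComodule A C) (m : M) (x : X) :
    (actQ X q M m).1 x = ev (atPoint q.1.l x) (M.coact m) := rfl

/-- The second connecting map: `(p ◇ q)(d) = p(d)⁰ q(p(d)¹)(-)`. -/
def diamond {h : IsPure A C L D} (p : homD h X) (q : QTilde L X) : BimodHom L L D X.endC :=
  ⟨AddMonoidHom.mk' (fun d => ⟨(actQ X q X (p.1 d)).1, (actQ X q X (p.1 d)).2⟩)
    (fun d d' => Subtype.ext (congrArg Subtype.val (map_add ((actQ X q X).comp p.1.1) d d'))), by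
    constructor
    · intro l d
      refine Subtype.ext (LinearMap.ext fun x => ?_)
      change ev (atPoint q.1.l x) (X.coact (p.1 (l • d))) =
        l • ev (atPoint q.1.l x) (X.coact (p.1 d))
      rw [p.1.2.1, Bicomodule.coact_smul]
      generalize X.coact (p.1 d) = w
      induction w using BTensor.induction_on with
      | tm y c => exact (smul_comm l _ y).symm
      | plus v w hv hw => rw [smul_add, map_add, map_add, smul_add, hv, hw]
    · intro l d
      refine Subtype.ext (LinearMap.ext fun x => ?_)
      change ev (atPoint q.1.l x) (X.coact (p.1 (op l • d))) =
        ev (atPoint q.1.l (l • x)) (X.coact (p.1 d))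
      have h1 : X.coact (op l • p.1 d) = op l • X.coact (p.1 d) :=
        (coactL L X).map_smul (op l) (p.1 d)
      rw [p.1.2.2, h1]
      generalize X.coact (p.1 d) = w
      induction w using BTensor.induction_on with
      | tm y c => exact congrArg (fun ξ : dual X => op (ξ x) • y) (q.1.2.2 l c)
      | plus v w hv hw => rw [smul_add, map_add, map_add, hv, hw]⟩

theorem evDual_map {N N' : Type*} [AddCommGroup N] [Module A N] [AddCommGroup N'] [Module A N']
    (ξ : dual X) (g : N →ₗ[A] N') (w : X ⊗ᴮ[A] N) :
    g (evDual ξ w) = evDual ξ (map LinearMap.id g w) := by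
  induction w using BTensor.induction_on with
  | tm x n => exact map_smul g (ξ x) n
  | plus v w hv hw => simp only [map_add, hv, hw]

theorem evDual_smul {N : Type*} [AddCommGroup N] [Module A N] (a : A) (ξ : dual X)
    (w : X ⊗ᴮ[A] N) : evDual (a • ξ) w = a • evDual ξ w := by
  induction w using BTensor.induction_on with
  | tm x n => exact mul_smul a (ξ x) n
  | plus v w hv hw => simp only [map_add, smul_add, hv, hw]

/-- The additive map `c ⊗ d ↦ q(c)(p(d)⁰) p(d)¹`. -/
def blackAdd {h : IsPure A C L D} (q : QTilde L X) (p : homD h X) : C ⊗ᴮ[L] D →+ C :=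
  BTensor.lift (fun c d => evDual (q.1 c) (X.coact (p.1 d)))
      (fun c c' d => by
        rw [map_add]
        exact map_add (evDualHom (X.coact (p.1 d))) (q.1 c) (q.1 c'))
      (fun c d d' => by rw [map_add, map_add, map_add])
      (fun l c d => by
        rw [q.1.2.2, p.1.2.1, Bicomodule.coact_smul]
        generalize X.coact (p.1 d) = w
        induction w using BTensor.induction_on with
        | tm x n => rfl
        | plus v w hv hw => rw [smul_add, map_add, map_add, hv, hw])

theorem blackAdd_tmul {h : IsPure A C L D} (q : QTilde L X) (p : homD h X) (c : C) (d : D) :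
    blackAdd X q p (tmul L c d) = evDual (q.1 c) (X.coact (p.1 d)) := rfl

theorem blackAdd_left {h : IsPure A C L D} (q : QTilde L X) (p : homD h X) (a : A)
    (z : C ⊗ᴮ[L] D) : blackAdd X q p (a • z) = a • blackAdd X q p z := by
  induction z using BTensor.induction_on with
  | tm c d => rw [left_smul_tmul, blackAdd_tmul, blackAdd_tmul, q.1.2.1, evDual_smul]
  | plus v w hv hw => rw [smul_add, map_add, map_add, smul_add, hv, hw]

theorem blackAdd_right {h : IsPure A C L D} (q : QTilde L X) (p : homD h X) (l : L)
    (z : C ⊗ᴮ[L] D) : blackAdd X q p (op l • z) = op l • blackAdd X q p z := by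
  induction z using BTensor.induction_on with
  | tm c d =>
    have h1 : X.coact (op l • p.1 d) = op l • X.coact (p.1 d) :=
      (coactL L X).map_smul (op l) (p.1 d)
    rw [right_smul_tmul, blackAdd_tmul, blackAdd_tmul, p.1.2.2, h1]
    generalize X.coact (p.1 d) = w
    induction w using BTensor.induction_on with
    | tm x n => exact smul_comm (q.1 c x) (op l) n
    | plus v w hv hw => rw [smul_add, map_add, map_add, smul_add, hv, hw]
  | plus v w hv hw => rw [smul_add, map_add, map_add, smul_add, hv, hw]

/-- The bimodule map `c ⊗ d ↦ q(c)(p(d)⁰) p(d)¹`. -/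
def blackAux {h : IsPure A C L D} (q : QTilde L X) (p : homD h X) :
    BimodHom A L (C ⊗ᴮ[L] D) C :=
  ⟨blackAdd X q p, blackAdd_left X q p, blackAdd_right X q p⟩

theorem blackAux_tmul {h : IsPure A C L D} (q : QTilde L X) (p : homD h X) (c : C) (d : D) :
    blackAux X q p (tmul L c d) = evDual (q.1 c) (X.coact (p.1 d)) := rfl

theorem comul_blackAux {h : IsPure A C L D} (q : QTilde L X) (p : homD h X) (z : C ⊗ᴮ[L] D) :
    Coring.comul (A := A) (blackAux X q p z) =
      map LinearMap.id (blackAux X q p).l (assoc (map (comulR A C L) LinearMap.id z)) := by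
  induction z using BTensor.induction_on with
  | tm c d =>
    have h1 : ∀ w : C ⊗ᴮ[A] C, map LinearMap.id (blackAux X q p).l (assoc (tmul L w d)) =
        ev (atPoint q.1.l (p.1 d)) (assoc.symm
          (map LinearMap.id (Coring.comul (A := A) (C := C)).l w)) := fun w => by
      induction w using BTensor.induction_on with
      | tm c' c'' =>
        rw [map_tmul, LinearMap.id_apply, ev_assoc_symm, BimodHom.l_apply, q.2]
        rfl
      | plus v w hv hw => rw [add_tmul, map_add, map_add, map_add, map_add, map_add, hv, hw]
    rw [blackAux_tmul, ← q.2]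
    refine (ev_map (atPoint q.1.l (p.1 d)) (Coring.comul (A := A) (C := C)).r
      (Coring.comul (A := A) c)).trans ?_
    refine Eq.trans ?_ (h1 (Coring.comul (A := A) c)).symm
    rw [← Coring.coassoc, AddEquiv.symm_apply_apply]
  | plus v w hv hw =>
    have h2 := map_add (blackAux X q p).1 v w
    have h3 := map_add (Coring.comul (A := A) (C := C)).1
      (blackAux X q p v) (blackAux X q p w)
    rw [h2, h3, hv, hw, map_add, map_add, map_add]

theorem tau_blackAux {h : IsPure A C L D} (q : QTilde L X) (p : homD h X) (z : C ⊗ᴮ[L] D) :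
    tauL A C L D (blackAux X q p z) = map (blackAux X q p).r LinearMap.id
      (assoc.symm (map LinearMap.id (Coring.comul (A := L) (C := D)).l z)) := by
  induction z using BTensor.induction_on with
  | tm c d =>
    rw [blackAux_tmul, evDual_map]
    have h1 : map LinearMap.id (tauL A C L D) (X.coact (p.1 d)) =
        assoc (map (coactL L X) LinearMap.id (map p.1.r LinearMap.id
          (Coring.comul (A := L) (C := D) d))) := by
      rw [← p.2, coactD_spec, AddEquiv.apply_symm_apply]
    rw [h1, map_tmul, BimodHom.l_apply, LinearMap.id_apply]
    generalize (Coring.comul (A := L) (C := D)) d = u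
    induction u using BTensor.induction_on with
    | tm d' d'' =>
      rw [map_tmul, map_tmul, assoc_symm_tmul, map_tmul, BimodHom.r_apply, BimodHom.r_apply,
        blackAux_tmul]
      change evDual (q.1 c) (assoc (tmul L (X.coact (p.1 d')) d'')) = _
      generalize X.coact (p.1 d') = w
      induction w using BTensor.induction_on with
      | tm x n => rfl
      | plus v w hv hw => rw [add_tmul, map_add, map_add, map_add, add_tmul, hv, hw]
    | plus v w hv hw => rw [tmul_add, map_add, map_add, map_add, map_add, map_add, map_add, hv, hw]
  | plus v w hv hw =>
    have h2 := map_add (blackAux X q p).1 v w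
    rw [h2, map_add, hv, hw, map_add, map_add, map_add]

/-- The first connecting map:
`(q ◆ p)(c) = q(c₀)(p(c₁)⁰) p(c₁)¹`, which equals `c¹ q(c²₀)(p(c²₁))`. -/
def blackDiamond {h : IsPure A C L D} (q : QTilde L X) (p : homD h X) : endCD A C L D :=
  ⟨⟨(blackAux X q p).1.comp (RightExtension.tau (A := A) (C := C) (L := L) (D := D)).1,
    fun a c => by
      rw [AddMonoidHom.comp_apply, AddMonoidHom.comp_apply,
        (RightExtension.tau (A := A) (C := C) (L := L) (D := D)).2.1, (blackAux X q p).2.1],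
    fun l c => by
      rw [AddMonoidHom.comp_apply, AddMonoidHom.comp_apply,
        (RightExtension.tau (A := A) (C := C) (L := L) (D := D)).2.2, (blackAux X q p).2.2]⟩,
    fun c => by
      refine (comul_blackAux X q p (tauL A C L D c)).trans ?_
      refine (congrArg _ (RightExtension.comul_colinear (A := A) (L := L) (D := D) c)).trans ?_
      rw [map_map]
      rfl,
    fun c => by
      refine (tau_blackAux X q p (tauL A C L D c)).trans ?_
      have h1 := RightExtension.coassoc (A := A) (L := L) (D := D) c
      rw [← AddEquiv.eq_symm_apply] at h1
      refine (congrArg _ h1.symm).trans ?_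
      rw [map_map]
      rfl⟩

theorem blackDiamond_add_right {h : IsPure A C L D} (q : QTilde L X) (p p' : homD h X) :
    blackDiamond X q (p + p') = blackDiamond X q p + blackDiamond X q p' := by
  refine Subtype.ext (Subtype.ext (AddMonoidHom.ext fun c => ?_))
  change blackAdd X q (p + p') (tauL A C L D c) =
    blackAdd X q p (tauL A C L D c) + blackAdd X q p' (tauL A C L D c)
  generalize tauL A C L D c = z
  induction z using BTensor.induction_on with
  | tm c d =>
    exact map_add ((evDual (q.1 c)).comp X.coact.toAddMonoidHom) (p.1 d) (p'.1 d)
  | plus v w hv hw => rw [map_add, map_add, map_add, hv, hw]; abel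

theorem blackDiamond_add_left {h : IsPure A C L D} (q q' : QTilde L X) (p : homD h X) :
    blackDiamond X (q + q') p = blackDiamond X q p + blackDiamond X q' p := by
  refine Subtype.ext (Subtype.ext (AddMonoidHom.ext fun c => ?_))
  change blackAdd X (q + q') p (tauL A C L D c) =
    blackAdd X q p (tauL A C L D c) + blackAdd X q' p (tauL A C L D c)
  generalize tauL A C L D c = z
  induction z using BTensor.induction_on with
  | tm c d => exact map_add (evDualHom (X.coact (p.1 d))) (q.1 c) (q'.1 c)
  | plus v w hv hw => rw [map_add, map_add, map_add, hv, hw]; abel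

theorem diamond_add_left {h : IsPure A C L D} (p p' : homD h X) (q : QTilde L X) :
    diamond X (p + p') q = diamond X p q + diamond X p' q :=
  Subtype.ext (AddMonoidHom.ext fun d => Subtype.ext
    (congrArg Subtype.val (map_add (actQ X q X) (p.1 d) (p'.1 d))))

theorem diamond_add_right {h : IsPure A C L D} (p : homD h X) (q q' : QTilde L X) :
    diamond X p (q + q') = diamond X p q + diamond X p q' :=
  Subtype.ext (AddMonoidHom.ext fun d => Subtype.ext (LinearMap.ext fun x =>
    map_add ((evHom (X.coact (p.1 d))).comp (atPointHom L x)) q.1 q'.1))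

/-- The connecting map `Q̃ ⊗ _L Hom^D(D, X) → ^C End^D(C)`, `q ⊗ p ↦ q ◆ p`. It is balanced over
`_L Hom_L(D, T)`; passing to the balanced tensor product, which is a quotient of `⊗ ℤ`, does not
change the image. -/
def blackDiamondHom (h : IsPure A C L D) :
    TensorProduct ℤ (QTilde L X) (homD h X) →+ endCD A C L D :=
  TensorProduct.liftAddHom (R := ℤ)
    (AddMonoidHom.mk' (fun q => AddMonoidHom.mk' (fun p => blackDiamond X q p)
      (blackDiamond_add_right X q))
      (fun q q' => AddMonoidHom.ext fun p => blackDiamond_add_left X q q' p))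
    (fun r q p => by rw [map_zsmul, map_zsmul]; rfl)

/-- The connecting map `_L Hom^D(D, X) ⊗ Q̃ → _L Hom_L(D, T)`, `p ⊗ q ↦ p ◇ q`. It is balanced over
`^C End^D(C)`; passing to the balanced tensor product, which is a quotient of `⊗ ℤ`, does not
change the image. -/
def diamondHom (h : IsPure A C L D) :
    TensorProduct ℤ (homD h X) (QTilde L X) →+ BimodHom L L D X.endC :=
  TensorProduct.liftAddHom (R := ℤ)
    (AddMonoidHom.mk' (fun p => AddMonoidHom.mk' (fun q => diamond X p q)
      (diamond_add_right X p))
      (fun p p' => AddMonoidHom.ext fun q => diamond_add_left X p p' q))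
    (fun r q p => by rw [map_zsmul, map_zsmul]; rfl)

/-- The Morita context of `X` is strict: both connecting maps are surjective. -/
def IsStrict (h : IsPure A C L D) : Prop :=
  Function.Surjective (blackDiamondHom X h) ∧ Function.Surjective (diamondHom X h)

end Extensions

end CoringExt

end

open CategoryTheory MulOpposite CoringExt

noncomputable section

namespace CoringExt

/-! The functors `- ⊗_T X` and `Hom^C(X, -)` are adjoint, with unit `n ↦ (x ↦ n ⊗ x)` and counit `f
⊗ x ↦ f x`. It is enough that both maps are bijective (`exists_equivalence`), and each surjectivity
in the strict Morita context supplies the inverse of one of them. The common tool is the action of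
`q ∈ Q̃` on any comodule `M`: it sends `m` to the colinear map `m q(-) : x ↦ m⁰ q(m¹)(x)`, naturally
in `M` (`actQ_hom`).

Unit. Writing each `v j` as a sum of elements `p ◇ q` and evaluating at `d j` turns `∑ v j (d j) =
1` into `∑ yᵢ qᵢ(-) = 1` in `T`, with `yᵢ ∈ X`. The inverse sends a colinear `f : X → N ⊗_T X` to `∑
f(yᵢ) qᵢ`, where `(n ⊗ y) q = n · (y q(-))` lies in `N` (`contract`). Naturality gives `f(x) = ∑
f(yᵢ qᵢ(x)) = ∑ (f(yᵢ) qᵢ) ⊗ x`; this is `indUnit_bijective`.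

Counit. Write the identity of `C` as `∑ qᵢ ◆ pᵢ`. With `m₀ ⊗ m₁` the `D`-coaction that purity
provides on `M`, the inverse is `m ↦ ∑ m₀ qᵢ(-) ⊗ pᵢ(m₁)`. Evaluating gives `∑ m⁰ ε((qᵢ ◆ pᵢ)(m¹)) =
m⁰ ε(m¹) = m` (`evalAdd_splitting_coactD`). In the other direction, a `C`-colinear `f` is also
`D`-colinear (`coactD_hom`), so the image of `f x` is `∑ f ∘ (x₀ qᵢ(-)) ⊗ pᵢ(x₁)`. The endomorphism
`x₀ qᵢ(-)` crosses the tensor sign over `T` (`splitting_hom`), and the first computation, now for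
`X`, leaves `f ⊗ x`; this is `evalAdd_bijective`. -/

section Equivalence

open RightComodule BTensor

/-! ### Unit and counit of the adjunction, and the equivalence criterion. -/

section UnitCounit

variable {A C : Type u} [Ring A] [AddCommGroup C] [Module A C] [Module Aᵐᵒᵖ C]
  [SMulCommClass A Aᵐᵒᵖ C] [Coring A C]

/-- The colinear map `x ↦ n ⊗ x`. -/
def indUnit (X : RightComodule A C) (N : ModuleCat.{u} X.endCᵐᵒᵖ) :
    N →ₗ[X.endCᵐᵒᵖ] homC X (indObj X N) where
  toFun n := ⟨tmulHom X N n, indCoact_tmul X N n⟩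
  map_add' n n' := Subtype.ext (LinearMap.ext fun x => add_tmul n n' x)
  map_smul' t n := Subtype.ext (LinearMap.ext fun x => smul_tmul t.unop n x)

/-- The evaluation map `f ⊗ x ↦ f x`. -/
def evalAdd (X M : RightComodule A C) : homC X M ⊗ᴮ[X.endC] X →+ M :=
  BTensor.lift (fun f x => f.1 x) (fun _ _ _ => rfl) (fun f x y => map_add f.1 x y)
    (fun _ _ _ => rfl)

@[simp] theorem evalAdd_tmul (X M : RightComodule A C) (f : homC X M) (x : X) :
    evalAdd X M (tmul X.endC f x) = f.1 x := rfl

/-- The map `n ⊗ x ↦ φ(n)(x)` on `N ⊗_T X` induced by a `T`-linear map `φ : N → Hom^C(X, M)`. -/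
def indLift {X M : RightComodule A C} {N : ModuleCat.{u} X.endCᵐᵒᵖ}
    (φ : N →ₗ[X.endCᵐᵒᵖ] homC X M) : N ⊗ᴮ[X.endC] X →ₗ[Aᵐᵒᵖ] M where
  toFun z := evalAdd X M (map φ LinearMap.id z)
  map_add' v w := by rw [map_add, map_add]
  map_smul' a z := by
    induction z using BTensor.induction_on with
    | tm n x => exact map_smul (φ n).1 a x
    | plus v w hv hw => rw [smul_add, map_add, map_add, map_add, map_add, hv, hw, smul_add]

theorem indLift_comp_tmulHom {X M : RightComodule A C} {N : ModuleCat.{u} X.endCᵐᵒᵖ}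
    (φ : N →ₗ[X.endCᵐᵒᵖ] homC X M) (n : N) : indLift φ ∘ₗ tmulHom X N n = (φ n).1 := rfl

/-- The coaction of `N ⊗_T X` acts only on the factor `X`, so on `n ⊗ x` the claim is the
colinearity of `φ n`. -/
theorem indLift_mem {X M : RightComodule A C} {N : ModuleCat.{u} X.endCᵐᵒᵖ}
    (φ : N →ₗ[X.endCᵐᵒᵖ] homC X M) (z : N ⊗ᴮ[X.endC] X) :
    M.coact (indLift φ z) = map (indLift φ) LinearMap.id (indCoact X N z) := by
  induction z using BTensor.induction_on with
  | tm n x =>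
    rw [indCoact_tmul, map_map, indLift_comp_tmulHom]
    exact (φ n).2 x
  | plus v w hv hw => rw [map_add, map_add, map_add, map_add, hv, hw]

/-- The evaluation map `f ⊗ x ↦ f x` as a map of comodules. -/
def evalHom (X M : RightComodule A C) : indObj X ((coinvFunctor X).obj M) ⟶ M :=
  -- The counit at `M` is the adjoint transpose of the identity of `Hom^C(X, M)`.
  ⟨indLift (N := (coinvFunctor X).obj M) LinearMap.id,
    indLift_mem (N := (coinvFunctor X).obj M) LinearMap.id⟩

theorem evalHom_apply (X M : RightComodule A C) (z : homC X M ⊗ᴮ[X.endC] X) :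
    (evalHom X M).1 z = evalAdd X M z := congrArg (evalAdd X M) (BTensor.map_id z)

/-- A morphism of comodules with an inverse map is an isomorphism. -/
theorem isIso_of_bijective {M N : RightComodule A C} (f : M ⟶ N)
    (hf : Function.Bijective f.1) : IsIso f := by
  let e : M ≃ₗ[Aᵐᵒᵖ] N := LinearEquiv.ofBijective f.1 hf
  -- Colinearity of the inverse is tested at `n = e m`, where colinearity of `f` makes `e` and its
  -- inverse cancel.
  have he : e.symm.toLinearMap ∈ homC N M := fun n => by
    obtain ⟨m, rfl⟩ := e.surjective n
    have h1 : N.coact (e m) = map e.toLinearMap LinearMap.id (M.coact m) := f.2 m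
    rw [h1, map_map]
    have h2 : e.symm.toLinearMap ∘ₗ e.toLinearMap = LinearMap.id := by
      ext x
      simp
    rw [h2, LinearMap.comp_id, map_id]
    exact congrArg M.coact (e.symm_apply_apply m)
  exact ⟨⟨⟨e.symm.toLinearMap, he⟩,
    Subtype.ext (LinearMap.ext fun m => e.symm_apply_apply m),
    Subtype.ext (LinearMap.ext fun n => e.apply_symm_apply n)⟩⟩

/-- The unit of the adjunction between `- ⊗_T X` and `Hom^C(X, -)`. -/
def indUnitTrans (X : RightComodule A C) :
    𝟭 (ModuleCat.{u} X.endCᵐᵒᵖ) ⟶ indFunctor X ⋙ coinvFunctor X where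
  app N := ModuleCat.ofHom (indUnit X N)
  naturality _ _ _ := rfl

/-- The counit of the adjunction between `- ⊗_T X` and `Hom^C(X, -)`. -/
def evalTrans (X : RightComodule A C) :
    coinvFunctor X ⋙ indFunctor X ⟶ 𝟭 (RightComodule A C) where
  app M := evalHom X M
  naturality M M' f := by
    refine Subtype.ext (LinearMap.toAddMonoidHom_injective ?_)
    exact BTensor.hom_ext (M := (coinvFunctor X).obj M) fun g x => rfl

/-- If unit and counit are bijective, the two functors are inverse equivalences. -/
theorem exists_equivalence (X : RightComodule A C)
    (hunit : ∀ N : ModuleCat.{u} X.endCᵐᵒᵖ, Function.Bijective (indUnit X N))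
    (hcounit : ∀ M : RightComodule A C, Function.Bijective (evalAdd X M)) :
    ∃ e : ModuleCat.{u} X.endCᵐᵒᵖ ≌ RightComodule A C,
      e.functor = indFunctor X ∧ e.inverse = coinvFunctor X := by
  have (N : ModuleCat.{u} X.endCᵐᵒᵖ) : IsIso ((indUnitTrans X).app N) :=
    (ConcreteCategory.isIso_iff_bijective _).2 (hunit N)
  have (M : RightComodule A C) : IsIso ((evalTrans X).app M) :=
    isIso_of_bijective (evalHom X M) (funext (evalHom_apply X M) ▸ hcounit M)
  have : IsIso (indUnitTrans X) := NatIso.isIso_of_isIso_app _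
  have : IsIso (evalTrans X) := NatIso.isIso_of_isIso_app _
  -- No triangle identity has to be checked: `Equivalence.mk` corrects the unit isomorphism to make
  -- one hold and leaves both functors untouched.
  exact ⟨CategoryTheory.Equivalence.mk (indFunctor X) (coinvFunctor X) (asIso (indUnitTrans X))
    (asIso (evalTrans X)), rfl, rfl⟩

end UnitCounit

/-! ### The action of `Q̃` on comodules, and bijectivity of the unit. -/

variable {A C L D : Type u} [Ring A] [AddCommGroup C] [Module A C] [Module Aᵐᵒᵖ C]
  [SMulCommClass A Aᵐᵒᵖ C] [Coring A C] [Ring L] [Module Lᵐᵒᵖ C] [SMulCommClass A Lᵐᵒᵖ C]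
  [ComulRightLinear A C L] (X : RightComodule A C) [Module L X] [SMulCommClass L Aᵐᵒᵖ X]
  [Bicomodule L X]

/-- For `q` in `Q̃`, the map `x ↦ x q(-)` from `X` to `T`. -/
def actEnd (q : QTilde L X) : X →+ X.endC :=
  AddMonoidHom.mk' (fun x => ⟨(actQ X q X x).1, (actQ X q X x).2⟩)
    (fun x y => Subtype.ext (congrArg Subtype.val (map_add (actQ X q X) x y)))

/-- `f(m) q(-) = f ∘ (m q(-))` for a colinear map `f`. -/
theorem actQ_hom (q : QTilde L X) {M M' : RightComodule A C} (f : homC M M') (m : M) (x : X) :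
    (actQ X q M' (f.1 m)).1 x = f.1 ((actQ X q M m).1 x) := by
  rw [actQ_apply, actQ_apply, ev_map, f.2 m]

/-- This is `actQ_hom` for an endomorphism of `X`. It is the balancing condition over `T` that makes
`contract` well defined. -/
theorem actEnd_smul (q : QTilde L X) (t : X.endC) (x : X) :
    actEnd X q (t • x) = t * actEnd X q x :=
  Subtype.ext (LinearMap.ext fun y => actQ_hom X q (⟨t.1, t.2⟩ : homC X X) x y)

/-- The map `n ⊗ x ↦ n (x q(-))` from `N ⊗_T X` to `N`. -/
def contract (q : QTilde L X) (N : ModuleCat.{u} X.endCᵐᵒᵖ) : N ⊗ᴮ[X.endC] X →+ N :=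
  BTensor.lift (fun n x => op (actEnd X q x) • n) (fun n n' x => smul_add _ n n')
    (fun n x y => by rw [map_add, MulOpposite.op_add, add_smul])
    (fun t n x => by rw [actEnd_smul, op_mul, mul_smul])

/-- Naturality along the colinear map `y ↦ n ⊗ y` gives `(n ⊗ y) q(-) = n ⊗ (y q(-))(x)` at `x`, and
`y q(-) ∈ T` moves to the left factor. Hence every colinear map of the form `z q(-)` lies in the
image of the unit. -/
theorem actQ_ind (q : QTilde L X) (N : ModuleCat.{u} X.endCᵐᵒᵖ) (z : N ⊗ᴮ[X.endC] X) (x : X) :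
    (actQ X q (indObj X N) z).1 x = tmul X.endC (contract X q N z) x := by
  induction z using BTensor.induction_on with
  | tm n y =>
    exact (actQ_hom X q (indUnit X N n) y x).trans (smul_tmul (actEnd X q y) n x).symm
  | plus v w hv hw =>
    rw [map_add (contract X q N), add_tmul, ← hv, ← hw]
    exact congrArg (fun f : homC X (indObj X N) => f.1 x) (map_add (actQ X q (indObj X N)) v w)

/-- The unit is bijective if `1` is in the image of `X ⊗ Q̃ → T`. -/
theorem indUnit_bijective {ι : Type*} (s : Finset ι) (y : ι → X) (q : ι → QTilde L X)
    (h : ∑ i ∈ s, actEnd X (q i) (y i) = 1) (N : ModuleCat.{u} X.endCᵐᵒᵖ) :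
    Function.Bijective (indUnit X N) := by
  have hsum (x : X) : ∑ i ∈ s, (actQ X (q i) X (y i)).1 x = x := by
    have h1 := congrArg (fun t : X.endC => t.1 x) h
    simp only [AddSubmonoidClass.coe_finsetSum, LinearMap.sum_apply] at h1
    exact h1
  -- The inverse of the unit applies `f` to the `yᵢ` and contracts each value with `qᵢ`. On `f = (x
  -- ↦ n ⊗ x)` this returns `n · ∑ yᵢ qᵢ(-) = n`.
  refine Function.bijective_iff_has_inverse.2
    ⟨fun f => ∑ i ∈ s, contract X (q i) N (f.1 (y i)), fun n => ?_, fun f => ?_⟩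
  · change ∑ i ∈ s, op (actEnd X (q i) (y i)) • n = n
    rw [← Finset.sum_smul, ← Finset.op_sum, h, op_one, one_smul]
  · refine Subtype.ext (LinearMap.ext fun x => ?_)
    -- Both sides are `(f(yᵢ) qᵢ(-))(x)`: by `actQ_ind` on the left, by naturality along `f` on the
    -- right.
    have h1 (i : ι) : (indUnit X N (contract X (q i) N (f.1 (y i)))).1 x =
        f.1 ((actQ X (q i) X (y i)).1 x) :=
      (actQ_ind X (q i) N (f.1 (y i)) x).symm.trans (actQ_hom X (q i) f (y i) x)
    rw [map_sum, AddSubgroup.val_finsetSum, LinearMap.sum_apply]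
    refine (Finset.sum_congr rfl fun i _ => h1 i).trans ?_
    rw [← map_sum, hsum]

/-! ### The splitting map, the `D`-coactions, and bijectivity of the counit. -/

variable [AddCommGroup D] [Module L D] [Module Lᵐᵒᵖ D] [SMulCommClass L Lᵐᵒᵖ D] [Coring L D]

variable (L) in
/-- A colinear map as a right `L`-linear map. -/
def homL {M M' : RightComodule A C} (f : homC M M') : M →ₗ[Lᵐᵒᵖ] M' where
  toFun := f.1
  map_add' := map_add f.1
  map_smul' l m := by
    rw [induced_smul, induced_smul, ev_map, f.2 m, RingHom.id_apply]
    exact congrArg (ev (counitL A C))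
      (map_smul (mapR f.1 (LinearMap.id : C →ₗ[A] C) (fun _ _ => rfl)) l (M.coact m))

/-- The coaction and `q` are right `L`-linear, and `L` acts on `X*` by precomposition with `x ↦ l
x`. This lets `l` pass through the tensor product over `T` in `splitting`, which is therefore
balanced over `L`. -/
theorem actQ_op_smul (q : QTilde L X) (M : RightComodule A C) (l : L) (m : M) :
    actQ X q M (op l • m) = op (unitMap L X l) • actQ X q M m := by
  refine Subtype.ext (LinearMap.ext fun x => ?_)
  change ev (atPoint q.1.l x) (M.coact (op l • m)) = ev (atPoint q.1.l (l • x)) (M.coact m)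
  have h1 : M.coact (op l • m) = op l • M.coact m := (coactL L M).map_smul (op l) m
  rw [h1]
  generalize M.coact m = w
  induction w using BTensor.induction_on with
  | tm y c => exact congrArg (fun ξ : dual X => op (ξ x) • y) (q.1.2.2 l c)
  | plus v w hv hw => rw [smul_add, map_add, map_add, hv, hw]

/-- The map `m ⊗ d ↦ m q(-) ⊗ p(d)`. -/
def splitting (q : QTilde L X) (p : BimodHom L L D X) (M : RightComodule A C) :
    M ⊗ᴮ[L] D →+ homC X M ⊗ᴮ[X.endC] X :=
  BTensor.lift (fun m d => tmul X.endC (actQ X q M m) (p d))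
    (fun m m' d => by rw [map_add, add_tmul])
    (fun m d d' => by rw [map_add, tmul_add])
    (fun l m d => by rw [actQ_op_smul, smul_tmul, p.2.1]; rfl)

/-- The map `c ⊗ d ↦ q(c)(p(d))`. -/
def pairing (q : QTilde L X) (p : BimodHom L L D X) : C ⊗ᴮ[L] D →ₗ[A] A where
  toFun := BTensor.lift (fun c d => q.1 c (p d))
    (fun c c' d => by rw [map_add]; rfl) (fun c d d' => by rw [map_add, map_add])
    (fun l c d => by rw [q.1.2.2, p.2.1, dual_smul])
  map_add' := map_add _
  map_smul' a z := by
    induction z using BTensor.induction_on with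
    | tm c d => exact congrArg (fun ξ : dual X => ξ (p d)) (q.1.2.1 a c)
    | plus v w hv hw => rw [smul_add, map_add, map_add, hv, hw, smul_add]

/-- Both sides send `m ⊗ d` to `m⁰ q(m¹)(p(d))`. The right side is arranged to contain `ϱ ⊗ D`, so
that the defining equation of `coactD` applies. -/
theorem evalAdd_splitting (q : QTilde L X) (p : BimodHom L L D X) (M : RightComodule A C)
    (z : M ⊗ᴮ[L] D) : evalAdd X M (splitting X q p M z) =
      rid (map LinearMap.id (pairing X q p) (assoc (map (coactL L M) LinearMap.id z))) := by
  induction z using BTensor.induction_on with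
  | tm m d =>
    change ev (atPoint q.1.l (p d)) (M.coact m) =
      rid (map LinearMap.id (pairing X q p) (assoc (tmul L (M.coact m) d)))
    generalize M.coact m = w
    induction w using BTensor.induction_on with
    | tm y c => rfl
    | plus v w hv hw => simp only [add_tmul, map_add, hv, hw]
  | plus v w hv hw => simp only [map_add, hv, hw]

/-- By linearity, `ε(ξ(x⁰) x¹) = ξ(x⁰) ε(x¹) = ξ(x⁰ ε(x¹)) = ξ(x)`. -/
theorem counit_evDual_coact (ξ : dual X) (x : X) :
    counitL A C (evDual ξ (X.coact x)) = ξ x := by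
  rw [evDual_map]
  -- On `A ⊗ A` the maps `lid` and `rid` are both the multiplication, so `rid_map` applies to an
  -- expression built with `lid`.
  exact (rid_map ξ _).trans (congrArg ξ (X.coact_counit x))

variable [RightExtension A C L D]

/-- The counit cancels the coaction on `p(c₁)`, leaving `q(c₀)(p(c₁))`. This links the scalars
produced by the splitting to the Morita map `◆`. -/
theorem counit_blackDiamond {h : IsPure A C L D} (q : QTilde L X) (p : homD h X) (c : C) :
    counitL A C ((blackDiamond X q p).1 c) = pairing X q p.1 (tauL A C L D c) := by
  change counitL A C (blackAdd X q p (tauL A C L D c)) = _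
  generalize tauL A C L D c = z
  induction z using BTensor.induction_on with
  | tm c d => exact counit_evDual_coact X (q.1 c) (p.1 d)
  | plus v w hv hw => rw [map_add, map_add, map_add, hv, hw]

/-- Colinear maps of `C`-comodules are colinear over `D`. -/
theorem coactD_hom (h : IsPure A C L D) {M M' : RightComodule A C} (f : homC M M') (m : M) :
    coactD h M' (f.1 m) = map (homL L f) LinearMap.id (coactD h M m) := by
  -- By purity `ϱ ⊗ D` is injective on `M' ⊗ D`. After composition with it, both sides become `f ⊗ C
  -- ⊗ D` applied to `(M ⊗ τ) ϱ(m)`.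
  apply (h.preserves M').1
  have h1 : coactL L M' ∘ₗ homL L f =
      mapR f.1 (LinearMap.id : C →ₗ[A] C) (S := L) (fun _ _ => rfl) ∘ₗ coactL L M :=
    LinearMap.ext f.2
  rw [coactD_spec, map_map, h1, ← map_map _ LinearMap.id, coactD_spec, f.2 m]
  generalize M.coact m = w
  induction w using BTensor.induction_on with
  | tm y c =>
    simp only [map_tmul, LinearMap.id_apply]
    generalize tauL A C L D c = z
    induction z using BTensor.induction_on with
    | tm c d => rfl
    | plus v w hv hw => simp only [tmul_add, map_add, hv, hw]
  | plus v w hv hw => simp only [map_add, hv, hw]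

/-- The equation `(ϱ ⊗ D) τ_M = (M ⊗ τ) ϱ` transfers the `D`-coaction from `M` to `C`: the value is
`m⁰ q(m¹₀)(p(m¹₁)) = m⁰ ε((q ◆ p)(m¹))`. -/
theorem evalAdd_splitting_coactD {h : IsPure A C L D} (q : QTilde L X) (p : homD h X)
    (M : RightComodule A C) (m : M) : evalAdd X M (splitting X q p.1 M (coactD h M m)) =
      ev ((counitL A C) ∘ₗ (blackDiamond X q p).1.l) (M.coact m) := by
  have h1 : counitL A C ∘ₗ (blackDiamond X q p).1.l = pairing X q p.1 ∘ₗ tauL A C L D :=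
    LinearMap.ext fun c => counit_blackDiamond X q p c
  rw [evalAdd_splitting, coactD_spec, AddEquiv.apply_symm_apply, map_map, h1]
  rfl

/-- Naturality gives `f(x) q(-) = f ∘ (x q(-))`; the endomorphism `x q(-)` then moves across the
tensor over `T` and is evaluated at `p(d)`. -/
theorem splitting_hom (q : QTilde L X) (p : BimodHom L L D X) {M : RightComodule A C}
    (f : homC X M) (z : X ⊗ᴮ[L] D) :
    splitting X q p M (map (homL L f) LinearMap.id z) =
      tmul X.endC f (evalAdd X X (splitting X q p X z)) := by
  induction z using BTensor.induction_on with
  | tm x d =>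
    have h1 : actQ X q M (f.1 x) = op (actEnd X q x) • f :=
      Subtype.ext (LinearMap.ext fun y => actQ_hom X q f x y)
    change tmul X.endC (actQ X q M (f.1 x)) (p d) = _
    rw [h1, smul_tmul]
    rfl
  | plus v w hv hw => simp only [map_add, tmul_add, hv, hw]

/-- The counit is bijective if `1` is in the image of `Q̃ ⊗ _L Hom^D(D, X) → ^C End^D(C)`. -/
theorem evalAdd_bijective {h : IsPure A C L D} {ι : Type*} (s : Finset ι) (q : ι → QTilde L X)
    (p : ι → homD h X) (hs : ∀ c : C, ∑ i ∈ s, (blackDiamond X (q i) (p i)).1 c = c)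
    (M : RightComodule A C) : Function.Bijective (evalAdd X M) := by
  -- A general comodule `N` is needed: surjectivity uses `N = M`, while injectivity uses `N = X`.
  have hsum (N : RightComodule A C) (m : N) :
      ∑ i ∈ s, evalAdd X N (splitting X (q i) (p i).1 N (coactD h N m)) = m := by
    simp only [evalAdd_splitting_coactD]
    refine Eq.trans ?_ (N.coact_counit m)
    generalize N.coact m = w
    induction w using BTensor.induction_on with
    | tm y c =>
      change ∑ i ∈ s, op (counitL A C ((blackDiamond X (q i) (p i)).1 c)) • y =
        op (counitL A C c) • y
      rw [← Finset.sum_smul, ← Finset.op_sum, ← map_sum, hs]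
    | plus v w hv hw => simp only [map_add, Finset.sum_add_distrib, hv, hw]
  -- The inverse of evaluation is `m ↦ ∑ m₀ qᵢ(-) ⊗ pᵢ(m₁)`.
  refine Function.bijective_iff_has_inverse.2
    ⟨fun m => ∑ i ∈ s, splitting X (q i) (p i).1 M (coactD h M m), fun z => ?_, fun m => ?_⟩
  · induction z using BTensor.induction_on with
    | tm f x =>
      simp only [evalAdd_tmul, coactD_hom, splitting_hom]
      -- Every term now has the form `f ⊗ -`, so the sum is taken inside the second factor, where
      -- `hsum` for `X` returns `x`.
      have h1 := map_sum (AddMonoidHom.mk' (tmul X.endC f) (tmul_add f))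
        (fun i => evalAdd X X (splitting X (q i) (p i).1 X (coactD h X x))) s
      rw [hsum] at h1
      exact h1.symm
    | plus v w hv hw => simp only [map_add, Finset.sum_add_distrib] at hv hw ⊢; rw [hv, hw]
  · rw [map_sum, hsum]

end Equivalence

end CoringExt

end

/-! ### Conclusion from strictness. -/

/-- **Strong Structure Theorem.** Let `C` be an `A`-coring, `D` an `L`-coring which is a pure right
extension of `C`, and `X` an `L`-`C` bicomodule with `T = End^C(X)`. If the Morita context of `X` is
strict and `1 = ∑ j, v j (d j)` in `T` for some `v j ∈ _L Hom_L(D, T)` and `d j ∈ D`, then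
`- ⊗_T X` and `Hom^C(X, -)` are inverse equivalences. -/
theorem mainTheorem5 {k : Type*} [CommRing k] {A C L D : Type u}
    [Ring A] [Algebra k A] [Ring L] [Algebra k L]
    [AddCommGroup C] [Module k C] [Module A C] [Module Aᵐᵒᵖ C] [SMulCommClass A Aᵐᵒᵖ C]
    [IsScalarTower k A C] [IsScalarTower k Aᵐᵒᵖ C] [Coring A C]
    [AddCommGroup D] [Module k D] [Module L D] [Module Lᵐᵒᵖ D] [SMulCommClass L Lᵐᵒᵖ D]
    [IsScalarTower k L D] [IsScalarTower k Lᵐᵒᵖ D] [Coring L D]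
    [Module Lᵐᵒᵖ C] [SMulCommClass A Lᵐᵒᵖ C] [IsScalarTower k Lᵐᵒᵖ C]
    [ComulRightLinear A C L] [RightExtension A C L D] (hpure : IsPure A C L D)
    (X : RightComodule A C) [Module k X] [Module L X] [SMulCommClass L Aᵐᵒᵖ X]
    [IsScalarTower k L X] [IsScalarTower k Aᵐᵒᵖ X] [Bicomodule L X]
    (hstrict : IsStrict X hpure)
    (hunit : ∃ (n : ℕ) (v : Fin n → BimodHom L L D X.endC) (d : Fin n → D),
      ∑ j, v j (d j) = 1) :
    ∃ e : ModuleCat.{u} X.endCᵐᵒᵖ ≌ RightComodule A C,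
      e.functor = indFunctor X ∧ e.inverse = coinvFunctor X := by
  obtain ⟨hblack, hdiamond⟩ := hstrict
  apply exists_equivalence
  · obtain ⟨n, v, d, hv⟩ := hunit
    choose t ht using fun j => hdiamond (v j)
    choose s hs using fun j => TensorProduct.exists_finset (t j)
    -- Evaluating `p ◇ q` at `d` gives precisely the endomorphism `p(d) q(-)`.
    have h1 (j : Fin n) : v j (d j) = ∑ i ∈ s j, actEnd X i.2 (i.1.1 (d j)) := by
      rw [← ht j, hs j, map_sum, AddSubgroup.val_finsetSum, AddMonoidHom.finsetSum_apply]
      rfl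
    -- An index is some `j` together with a term `p ⊗ q` of the preimage of `v j`; the corresponding
    -- element of `X` is `p (d j)`.
    refine indUnit_bijective X (Finset.univ.sigma s) (fun i => i.2.1.1 (d i.1)) (fun i => i.2.2) ?_
    rw [Finset.sum_sigma, ← hv]
    exact Finset.sum_congr rfl fun j _ => (h1 j).symm
  -- The identity of `C` is the unit of `^C End^D(C)`; a preimage under `◆` supplies the pairs `(qᵢ,
  -- pᵢ)`.
  · let one : endCD A C L D := ⟨⟨AddMonoidHom.id C, fun _ _ => rfl, fun _ _ => rfl⟩,
      fun c => (BTensor.map_id _).symm, fun c => (BTensor.map_id _).symm⟩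
    obtain ⟨t, ht⟩ := hblack one
    obtain ⟨s, hs⟩ := TensorProduct.exists_finset t
    refine evalAdd_bijective X s (fun i => i.1) (fun i => i.2) fun c => ?_
    have h1 := congrArg (fun u : endCD A C L D => u.1 c) ht
    rw [hs, map_sum] at h1
    simp only [AddSubgroup.val_finsetSum, AddMonoidHom.finsetSum_apply] at h1
    exact h1
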